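/- **Setting.** Let $(\Theta,d)$ be a metric space with a $\sigma$-algebra containing the open sets and a measure $\bar\mu$; let $\mathcal X$ (prompts) and $\mathcal A$ (arms) be measurable spaces, and let $r_\theta(x,a)$ be a jointly measurable family of rewards with $|r_\theta(x,a)|\le B$ and $\theta\mapsto r_\theta(x,a)$ $L_0$-Lipschitz for all $x,a$, where $L_0>0$. The true parameter is some $\theta_*\in\Theta$. Let $p_0>0$ be a probability density with respect to $\bar\mu$ such that $\log p_0$ is $L$-Lipschitz on $\Theta$. Write $\Delta r_\theta(x,a^1,a^2)=r_\theta(x,a^1)-r_\theta(x,a^2)$ and $\sigma(z)=\log(1+e^{-z})$. Let $\mathrm{dc}>0$ be a decoupling coefficient, i.e. a number such that for all $\lambda>0$, all $x\in\mathcal X$ and all probability measures $P$ on $\Theta\times\mathcal A\times\mathcal A$, $$\mathbb E_{(\theta,a^1,a^2)\sim P}[\Delta r_\theta(x,a^1,a^2)-\Delta r_{\theta_*}(x,a^1,a^2)]\le\lambda\,\mathrm{dc}+\frac1{4\lambda}\mathbb E_{\tilde\theta\sim P|_\theta}\mathbb E_{(a^1,a^2)\sim P|_{(a^1,a^2)}}[\Delta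 r_{\tilde\theta}(x,a^1,a^2)-\Delta r_{\theta_*}(x,a^1,a^2)]^2 .$$ **Algorithm (modified FGTS.CDB with parameters $\eta,\mu$).** In each round $t=1,\dots,T$ a prompt $x_t$ and an action space $\mathcal A_t\subset\mathcal A$ are revealed (possibly at random and depending on the past). Given the data $S_{t-1}=\{(x_i,\mathcal A_i,a_i^1,a_i^2,y_i)\}_{i<t}$, together with $x_t$ and $\mathcal A_t$, the learner samples independently, for $j=1,2$, $\theta_t^j$ from $$p^j(\theta|S_{t-1})\propto\exp\Big(-\sum_{i<t}\Big[\eta\,\sigma\big(y_i\Delta r_\theta(x_i,a_i^1,a_i^2)\big)-\mu\max_{a'\in\mathcal A_i}\Delta r_\theta(x_i,a',a_i^{3-j})\Big]\Big)p_0(\theta)$$ and plays $a_t^j\in\arg\max_{a\in\mathcal A_t}r_{\theta_t^j}(x_t,a)$ (the maxima are attained, and ties are broken by a measurable rule that may depend on the past). It then observes $y_t\in\{\pm1\}$ with $\mathbb P(y_t=1)=e^{r_{\theta_*}(x_t,a_t^1)}/(e^{r_{\theta_*}(x_t,a_t^1)}+e^{r_{\theta_*}(x_t,a_t^2)})$ given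 the past, $x_t$, $\mathcal A_t$ and the two arms. Let $$\mathrm{Regret}(T)=\sum_{t=1}^T\Big[\max_{a\in\mathcal A_t}r_{\theta_*}(x_t,a)-\tfrac12\big(r_{\theta_*}(x_t,a_t^1)+r_{\theta_*}(x_t,a_t^2)\big)\Big].$$ **Theorem.** For $T\ge1$ put $$\ell_T=\log\frac1{p_0(\theta_*)\,\bar\mu(\{\theta:d(\theta,\theta_*)\le2/(L_0T)\})}$$ and consider those $T$ for which $0<\ell_T<\infty$. If the algorithm is run for $T$ rounds with $\eta=0.25$ and $\mu=\frac{e^{-B}}5\sqrt{\ell_T/(T\,\mathrm{dc})}$, then $\mathrm{Regret}(T)$ is integrable and $$\mathbb E[\mathrm{Regret}(T)]\le4+5e^B\sqrt{T\,\mathrm{dc}\,\ell_T}\;\Big[2+\frac{1+2L/(L_0T)}{\ell_T}\Big].$$ In particular $\mathbb E[\mathrm{Regret}(T)]=O(\sqrt{T\,\mathrm{dc}\,\ell_T})$ for a fixed problem, i.e. there is a constant $C$ independent of $T$, of how the prompts and action spaces are generated and of the tie-breaking, with $\mathbb E[\mathrm{Regret}(T)]\le C\sqrt{T\,\mathrm{dc}\,\ell_T}$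 for all such $T$. -/

import Mathlib

open MeasureTheory ProbabilityTheory

noncomputable section

namespace FGTS

variable {Θ X S A Ω : Type*}

/-- One round of data `(x, s, (a¹, a²), y)`: the prompt, the label of the action space on offer, the
two arms (`0` is the first arm, `1` the second), and the preference (`true` means that the first arm
is preferred, i.e. `y = 1`; `false` means `y = -1`). -/
abbrev Obs (X S A : Type*) := X × S × (Fin 2 → A) × Bool

/-- The data collected in the first `t` rounds. -/
abbrev Past (X S A : Type*) (t : ℕ) := Fin t → Obs X S A

/-- What the learner knows when it chooses its arms after `t` complete rounds: the collected data,
the current prompt and the current action space. -/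
abbrev Hist (X S A : Type*) (t : ℕ) := Past X S A t × X × S

/-- `Δr_θ(x, a, b) = r_θ(x, a) - r_θ(x, b)`. -/
def rewardDiff (r : Θ → X → A → ℝ) (θ : Θ) (x : X) (a b : A) : ℝ := r θ x a - r θ x b

/-- `σ(z) = log (1 + exp (-z))`. -/
def logLoss (z : ℝ) : ℝ := Real.log (1 + Real.exp (-z))

/-- The preference as a real number, `1` or `-1`. -/
def sgn (y : Bool) : ℝ := if y then 1 else -1

/-- The Feel-Good likelihood function
`L^j(θ, x, a¹, a², y) = η σ(y Δr_θ(x, a¹, a²)) - μ max_{b} Δr_θ(x, b, a^{3-j})`,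
where `b` ranges over the action space of that round. (`1 - j` is the index of the other arm.) -/
def feelGoodLoss (r : Θ → X → A → ℝ) (act : S → Set A) (η μ : ℝ) (j : Fin 2) (θ : Θ)
    (o : Obs X S A) : ℝ :=
  match o with
  | (x, s, a, y) =>
    η * logLoss (sgn y * rewardDiff r θ x (a 0) (a 1))
      - μ * ⨆ b : act s, rewardDiff r θ x b (a (1 - j))

/-- The prior distribution, with density `p₀` with respect to `μbar`. -/
def prior [MeasurableSpace Θ] (μbar : Measure Θ) (p₀ : Θ → ℝ) : Measure Θ :=
  μbar.withDensity fun θ => ENNReal.ofReal (p₀ θ)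

/-- The sampling distribution of the `j`-th parameter,
`p^j(θ | S) ∝ exp (- ∑ᵢ L^j(θ, xᵢ, aᵢ¹, aᵢ², yᵢ)) p₀(θ)`, normalized to total mass one. -/
def fgPosterior [MeasurableSpace Θ] (r : Θ → X → A → ℝ) (act : S → Set A) (μbar : Measure Θ)
    (p₀ : Θ → ℝ) (η μ : ℝ) (j : Fin 2) {t : ℕ} (h : Past X S A t) : Measure Θ :=
  (prior μbar p₀).tilted fun θ => -∑ i, feelGoodLoss r act η μ j θ (h i)

/-- The probability that the first arm is preferred in the Bradley-Terry-Luce model. -/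
def btlProb (r : Θ → X → A → ℝ) (θs : Θ) (x : X) (a : Fin 2 → A) : ℝ :=
  Real.exp (r θs x (a 0)) / (Real.exp (r θs x (a 0)) + Real.exp (r θs x (a 1)))

/-- The law of the preference in the Bradley-Terry-Luce model. -/
def btl (r : Θ → X → A → ℝ) (θs : Θ) (x : X) (a : Fin 2 → A) : Measure Bool :=
  ENNReal.ofReal (btlProb r θs x a) • Measure.dirac true
    + ENNReal.ofReal (1 - btlProb r θs x a) • Measure.dirac false

/-- The conditional distribution of `Z` given `H` under `Pr` is `κ H`. -/
def HasCondLaw {𝓗 𝓩 : Type*} [MeasurableSpace Ω] [MeasurableSpace 𝓗] [MeasurableSpace 𝓩]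
    (Z : Ω → 𝓩) (H : Ω → 𝓗) (κ : 𝓗 → Measure 𝓩) (Pr : Measure Ω) : Prop :=
  ∃ K : Kernel 𝓗 𝓩, (∀ h, K h = κ h) ∧ HasCondDistrib Z H K Pr

/-- The random variables of an interaction: for each round `t = 0, 1, …` the prompt, the label of
the action space, the two sampled parameters, the two arms and the preference. -/
structure Interaction (Ω Θ X S A : Type*) where
  x : ℕ → Ω → X
  s : ℕ → Ω → S
  θ : ℕ → Fin 2 → Ω → Θ
  a : ℕ → Fin 2 → Ω → A
  y : ℕ → Ω → Bool

namespace Interaction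

/-- The data of round `t`. -/
def obs (p : Interaction Ω Θ X S A) (t : ℕ) (ω : Ω) : Obs X S A :=
  (p.x t ω, p.s t ω, fun j => p.a t j ω, p.y t ω)

/-- The data of the first `t` rounds together with the prompt and action space of the next one. -/
def hist (p : Interaction Ω Θ X S A) (t : ℕ) (ω : Ω) : Hist X S A t :=
  (fun i => p.obs i ω, p.x t ω, p.s t ω)

/-- The regret `∑ₜ [max_b r_*(xₜ, b) - (r_*(xₜ, aₜ¹) + r_*(xₜ, aₜ²)) / 2]` of the first `T` rounds,
the maximum being over the action space of round `t`. -/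
def regret (p : Interaction Ω Θ X S A) (r : Θ → X → A → ℝ) (act : S → Set A) (θs : Θ) (T : ℕ)
    (ω : Ω) : ℝ :=
  ∑ t ∈ Finset.range T,
    ((⨆ b : act (p.s t ω), r θs (p.x t ω) b)
      - (r θs (p.x t ω) (p.a t 0 ω) + r θs (p.x t ω) (p.a t 1 ω)) / 2)

end Interaction

/-- `p` is a run of FGTS.CDB for `T` rounds with hyperparameters `η, μ`, against preferences
generated by the true parameter `θs`. The prompts and action spaces may be chosen in any way, random
or not, depending on the past. -/
structure IsFGTSRun [MeasurableSpace Θ] [MeasurableSpace X] [MeasurableSpace S] [MeasurableSpace A]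
    [MeasurableSpace Ω] (p : Interaction Ω Θ X S A) (Pr : Measure Ω) (r : Θ → X → A → ℝ)
    (act : S → Set A) (μbar : Measure Θ) (p₀ : Θ → ℝ) (θs : Θ) (η μ : ℝ) (T : ℕ) : Prop where
  /-- Given the past, the prompt and the action space, the two parameters are sampled independently
  from the two posterior distributions. -/
  sample : ∀ t < T,
    HasCondLaw (fun ω => (p.θ t 0 ω, p.θ t 1 ω)) (p.hist t)
      (fun h => (fgPosterior r act μbar p₀ η μ 0 h.1).prod (fgPosterior r act μbar p₀ η μ 1 h.1)) Pr
  /-- The `j`-th arm is a maximizer of the `j`-th sampled reward over the current action space; ties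
  are broken by some measurable rule, which may depend on the round, the arm and the past. -/
  arm : ∀ t < T, ∀ j, ∃ rule : Hist X S A t × Θ → A, Measurable rule ∧
    (∀ h θ, rule (h, θ) ∈ act h.2.2 ∧ IsMaxOn (r θ h.2.1) (act h.2.2) (rule (h, θ))) ∧
    ∀ᵐ ω ∂Pr, p.a t j ω = rule (p.hist t ω, p.θ t j ω)
  /-- Given the past, the prompt, the action space and the two arms, the preference follows the
  Bradley-Terry-Luce model. -/
  preference : ∀ t < T,
    HasCondLaw (p.y t) (fun ω => (p.hist t ω, fun j => p.a t j ω))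
      (fun z => btl r θs z.1.2.1 z.2) Pr

/-- `dc` is a decoupling coefficient of the reward class at `θs`. -/
def IsDecouplingCoeff [MeasurableSpace Θ] [MeasurableSpace A] (r : Θ → X → A → ℝ) (θs : Θ)
    (dc : ℝ) : Prop :=
  ∀ lam : ℝ, 0 < lam → ∀ (x : X) (P : Measure (Θ × A × A)), IsProbabilityMeasure P →
    ∫ z, (rewardDiff r z.1 x z.2.1 z.2.2 - rewardDiff r θs x z.2.1 z.2.2) ∂P
      ≤ lam * dc + 1 / (4 * lam) *
        ∫ θ, ∫ b, (rewardDiff r θ x b.1 b.2 - rewardDiff r θs x b.1 b.2) ^ 2 ∂P.snd ∂P.fst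

/-- `log (1 / [p₀(θ_*) μbar({θ : d(θ, θ_*) ≤ 2 / (L₀ T)})])`. -/
def logTerm [MetricSpace Θ] [MeasurableSpace Θ] (μbar : Measure Θ) (p₀ : Θ → ℝ) (θs : Θ)
    (L₀ : ℝ) (T : ℕ) : ℝ :=
  Real.log (1 / (p₀ θs * μbar.real {θ | dist θ θs ≤ 2 / (L₀ * T)}))

end FGTS

end

open FGTS

namespace FGTS

/-! ### The logistic loss -/

/-! For each arm `j` the regret is played off against a potential, the log-partition function `log ∫
exp (-∑ᵢ lossGap) ∂prior`, with losses measured relative to the true parameter. Its increment in a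
round is the logarithm of a posterior mean, so the increments telescope
(`sum_log_integral_exp_tilted`). On every sample path their sum is bounded below through the prior
mass of the ball of radius `2 / (L₀ T)`, on which rewards are within `2 / T` of the true ones
(`log_integral_exp_ge`, `prior_real_ge`).

Conversely, each increment is bounded above in mean. Averaged over the preference it is at most `-c
E[(Δr_θ - Δr_*)²] + μ E[feelGoodGap] + 16 μ² B²`, where `c = exp (-2B) / 64` and `θ` is a fresh draw
from the `j`-th posterior (`IsRewardClass.integral_btl_log_le`). AM-GM separates the likelihood from
the Feel-Good part: the former becomes a Hellinger affinity because `2η = 1/2`, the latter is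
handled by Hoeffding's lemma.

The regret of arm `j` equals `Δr_θ - Δr_*` at the sampled `θ` and the played arms, minus the
Feel-Good gap of that `θ` against the other arm. Since the other arm comes from an independent draw,
this gap has the same mean for a fresh `θ`, and decoupling bounds the difference by a squared error
for a fresh `θ` (`IsRewardClass.integral_regret_le`). With `λ = 16 exp (2B) μ`, both the squares and
the gaps cancel in `μ · regret + increment` (`IsRewardClass.round_bound`).

Summing over rounds and dividing by `μ` gives the bound (`tuned_bound`). Absorbing the `B²` term
needs `dc ≥ 1`, which holds as soon as some reward difference deviates from the true one
(`IsDecouplingCoeff.one_le`); otherwise the played arms are optimal and there is no regret. -/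

lemma exp_neg_logLoss (z : ℝ) : Real.exp (-logLoss z) = (1 + Real.exp (-z))⁻¹ := by
  rw [logLoss, Real.exp_neg, Real.exp_log (by positivity)]

lemma logLoss_sub_le (u v : ℝ) : logLoss u - logLoss v ≤ |u - v| := by
  have h : Real.log (1 + Real.exp (-u)) ≤ Real.log (Real.exp |u - v| * (1 + Real.exp (-v))) := by
    apply Real.log_le_log (by positivity)
    have h1 : (1 : ℝ) ≤ Real.exp |u - v| := Real.one_le_exp (abs_nonneg _)
    have h2 : Real.exp (-u) ≤ Real.exp |u - v| * Real.exp (-v) := by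
      rw [← Real.exp_add]
      apply Real.exp_le_exp.2
      linarith [neg_abs_le (u - v)]
    linarith
  rw [Real.log_mul (Real.exp_ne_zero _) (by positivity), Real.log_exp] at h
  unfold logLoss
  linarith

lemma abs_logLoss_sub_le (u v : ℝ) : |logLoss u - logLoss v| ≤ |u - v| := by
  rw [abs_le]
  have h1 := logLoss_sub_le u v
  have h2 := logLoss_sub_le v u
  rw [abs_sub_comm] at h2
  constructor <;> linarith

lemma measurable_logLoss : Measurable logLoss := by
  unfold logLoss
  fun_prop

/-- `exp (-σ(z) / 2)` in terms of `exp (z / 2)`. -/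
lemma exp_neg_half_logLoss (z : ℝ) :
    Real.exp (-(1 / 2) * logLoss z) = Real.exp (z / 2) / √(Real.exp (z / 2) ^ 2 + 1) := by
  have h1 : Real.exp (-(1 / 2) * logLoss z) = √(Real.exp (-logLoss z)) := by
    rw [Real.sqrt_eq_rpow, ← Real.exp_mul]
    congr 1
    ring
  have h2 : Real.exp (z / 2) ^ 2 = Real.exp z := by
    rw [← Real.exp_nat_mul]
    congr 1
    push_cast
    ring
  have h3 : Real.exp (z / 2) = √(Real.exp z) := by
    rw [← h2, Real.sqrt_sq (Real.exp_pos _).le]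
  rw [h1, exp_neg_logLoss, h2, h3, ← Real.sqrt_div (Real.exp_pos _).le, Real.exp_neg]
  congr 1
  have := Real.exp_pos z
  field_simp

/-- A lower bound for the squared Hellinger distance of two Bernoulli distributions with
log-odds `u` and `v`. -/
lemma hellinger_affinity_le {B u v : ℝ} (hu : |u| ≤ 2 * B) (hv : |v| ≤ 2 * B) :
    Real.exp (-(1 / 2) * logLoss u) * Real.exp (-(1 / 2) * logLoss v)
      + Real.exp (-(1 / 2) * logLoss (-u)) * Real.exp (-(1 / 2) * logLoss (-v))
      ≤ 1 - Real.exp (-(2 * B)) / 32 * (u - v) ^ 2 := by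
  simp only [exp_neg_half_logLoss]
  have e : ∀ z : ℝ, Real.exp (-z / 2) / √(Real.exp (-z / 2) ^ 2 + 1)
      = 1 / √(Real.exp (z / 2) ^ 2 + 1) := by
    intro z
    have hz := Real.exp_pos (z / 2)
    rw [neg_div, Real.exp_neg]
    have : (Real.exp (z / 2))⁻¹ ^ 2 + 1 = (Real.exp (z / 2) ^ 2 + 1) / Real.exp (z / 2) ^ 2 := by
      field_simp
      ring
    rw [this, Real.sqrt_div (by positivity), Real.sqrt_sq hz.le]
    field_simp
  rw [e, e]
  set a := Real.exp (u / 2) with ha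
  set b := Real.exp (v / 2) with hb
  have ha0 : 0 < a := Real.exp_pos _
  have hb0 : 0 < b := Real.exp_pos _
  set p := √(a ^ 2 + 1)
  set q := √(b ^ 2 + 1)
  have hp : p ^ 2 = a ^ 2 + 1 := Real.sq_sqrt (by positivity)
  have hq : q ^ 2 = b ^ 2 + 1 := Real.sq_sqrt (by positivity)
  have hp0 : 0 < p := Real.sqrt_pos.2 (by positivity)
  have hq0 : 0 < q := Real.sqrt_pos.2 (by positivity)
  set ρ := a / p * (b / q) + 1 / p * (1 / q) with hρ
  -- Lagrange's identity `(a² + 1)(b² + 1) - (ab + 1)² = (a - b)²`.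
  have hsq : ρ ^ 2 = 1 - (a - b) ^ 2 / ((a ^ 2 + 1) * (b ^ 2 + 1)) := by
    have : ρ = (a * b + 1) / (p * q) := by
      rw [hρ]
      field_simp
    rw [this, div_pow, mul_pow, hp, hq]
    field_simp
    ring
  -- the numerator
  have hnum : a * b * ((u - v) ^ 2 / 4) ≤ (a - b) ^ 2 := by
    have hs : (a - b) ^ 2 = a * b * (4 * Real.sinh ((u - v) / 4) ^ 2) := by
      have hc : ∀ z : ℝ, Real.exp (z / 2) = Real.exp (z / 4) * Real.exp (z / 4) := by
        intro z
        rw [← Real.exp_add]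
        congr 1
        ring
      have h1 := Real.exp_pos (u / 4)
      have h2 := Real.exp_pos (v / 4)
      rw [Real.sinh_eq, ha, hb, hc, hc,
        show (u - v) / 4 = u / 4 + -(v / 4) by ring, neg_add, neg_neg, Real.exp_add, Real.exp_add,
        Real.exp_neg, Real.exp_neg]
      field_simp
      ring
    have hsinh : ((u - v) / 4) ^ 2 ≤ Real.sinh ((u - v) / 4) ^ 2 := by
      apply sq_le_sq.2
      rw [Real.abs_sinh]
      exact Real.self_le_sinh_iff.2 (abs_nonneg _)
    rw [hs]
    apply mul_le_mul_of_nonneg_left _ (by positivity)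
    linarith [hsinh]
  -- the denominator
  have hden : ∀ z : ℝ, |z| ≤ 2 * B →
      Real.exp (z / 2) ^ 2 + 1 ≤ 2 * Real.exp B * Real.exp (z / 2) := by
    intro z hz
    have h1 := Real.exp_pos (z / 2)
    have h2 : Real.exp (z / 2) ≤ Real.exp B := Real.exp_le_exp.2 (by linarith [(abs_le.1 hz).2])
    have h3 : 1 ≤ Real.exp B * Real.exp (z / 2) := by
      rw [← Real.exp_add]
      exact Real.one_le_exp (by linarith [(abs_le.1 hz).1])
    nlinarith
  have hD : (a ^ 2 + 1) * (b ^ 2 + 1) ≤ 4 * Real.exp (2 * B) * (a * b) := by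
    calc (a ^ 2 + 1) * (b ^ 2 + 1) ≤ (2 * Real.exp B * a) * (2 * Real.exp B * b) :=
          mul_le_mul (hden u hu) (hden v hv) (by positivity) (by positivity)
      _ = 4 * Real.exp (2 * B) * (a * b) := by
          rw [two_mul B, Real.exp_add]
          ring
  have hfrac : Real.exp (-(2 * B)) / 16 * (u - v) ^ 2
      ≤ (a - b) ^ 2 / ((a ^ 2 + 1) * (b ^ 2 + 1)) := by
    rw [le_div_iff₀ (by positivity)]
    calc Real.exp (-(2 * B)) / 16 * (u - v) ^ 2 * ((a ^ 2 + 1) * (b ^ 2 + 1))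
        ≤ Real.exp (-(2 * B)) / 16 * (u - v) ^ 2 * (4 * Real.exp (2 * B) * (a * b)) :=
          mul_le_mul_of_nonneg_left hD (by positivity)
      _ = (Real.exp (-(2 * B)) * Real.exp (2 * B)) * (a * b * ((u - v) ^ 2 / 4)) := by ring
      _ = a * b * ((u - v) ^ 2 / 4) := by rw [← Real.exp_add]; simp
      _ ≤ _ := hnum
  -- `2ρ ≤ 1 + ρ²` passes from `ρ²` to `ρ` and halves the constant `1/16`.
  nlinarith [sq_nonneg (1 - ρ)]

/-! ### Bounded integrands -/

section Bounded

variable {E : Type*} [MeasurableSpace E] {ν : Measure E}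

lemma integrable_of_abs_le [IsFiniteMeasure ν] {f : E → ℝ} (hf : Measurable f) {K : ℝ}
    (hK : ∀ e, |f e| ≤ K) : Integrable f ν :=
  Integrable.of_bound hf.aestronglyMeasurable K (Filter.Eventually.of_forall hK)

lemma abs_integral_le_of_abs_le [IsProbabilityMeasure ν] {f : E → ℝ} {K : ℝ}
    (hK : ∀ e, |f e| ≤ K) : |∫ e, f e ∂ν| ≤ K := by
  have := norm_integral_le_of_norm_le_const (μ := ν) (f := f) (C := K)
    (Filter.Eventually.of_forall hK)
  simpa using this

lemma exp_neg_le_integral_exp [IsProbabilityMeasure ν] {f : E → ℝ} (hf : Measurable f) {K : ℝ}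
    (hK : ∀ e, |f e| ≤ K) : Real.exp (-K) ≤ ∫ e, Real.exp (f e) ∂ν := by
  have hi : Integrable (fun e => Real.exp (f e)) ν :=
    integrable_of_abs_le hf.exp (K := Real.exp K) fun e => by
      rw [Real.abs_exp]
      exact Real.exp_le_exp.2 (abs_le.1 (hK e)).2
  calc Real.exp (-K) = ∫ _, Real.exp (-K) ∂ν := by simp
    _ ≤ _ := integral_mono (integrable_const _) hi fun e =>
        Real.exp_le_exp.2 (abs_le.1 (hK e)).1

lemma integral_exp_le_exp [IsProbabilityMeasure ν] {f : E → ℝ} (hf : Measurable f) {K : ℝ}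
    (hK : ∀ e, |f e| ≤ K) : ∫ e, Real.exp (f e) ∂ν ≤ Real.exp K := by
  have hi : Integrable (fun e => Real.exp (f e)) ν :=
    integrable_of_abs_le hf.exp (K := Real.exp K) fun e => by
      rw [Real.abs_exp]
      exact Real.exp_le_exp.2 (abs_le.1 (hK e)).2
  calc ∫ e, Real.exp (f e) ∂ν ≤ ∫ _, Real.exp K ∂ν :=
        integral_mono hi (integrable_const _) fun e => Real.exp_le_exp.2 (abs_le.1 (hK e)).2
    _ = _ := by simp

lemma abs_log_integral_exp_le [IsProbabilityMeasure ν] {f : E → ℝ} (hf : Measurable f) {K : ℝ}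
    (hK : ∀ e, |f e| ≤ K) : |Real.log (∫ e, Real.exp (f e) ∂ν)| ≤ K := by
  have h1 := exp_neg_le_integral_exp (ν := ν) hf hK
  have h2 := integral_exp_le_exp (ν := ν) hf hK
  have h0 := (Real.exp_pos (-K)).trans_le h1
  rw [abs_le]
  exact ⟨(Real.le_log_iff_exp_le h0).2 h1, (Real.log_le_iff_le_exp h0).2 h2⟩

/-- Splitting a log-moment: the first summand enters through its exponential moment, the second
one through its mean and Hoeffding's lemma. -/
lemma log_integral_exp_add_le [IsProbabilityMeasure ν] {U V : E → ℝ} (hU : Measurable U)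
    (hV : Measurable V) {K c : ℝ} (hUK : ∀ e, |U e| ≤ K) (hVc : ∀ e, |V e| ≤ c) :
    Real.log (∫ e, Real.exp (U e + V e) ∂ν)
      ≤ (1 / 2) * (∫ e, Real.exp (2 * U e) ∂ν - 1) + ∫ e, V e ∂ν + c ^ 2 := by
  set m := ∫ e, V e ∂ν with hm
  -- Hoeffding's lemma at the point `2`: an interval of length `2c` gives variance proxy `c²`.
  have hmgf : ∫ e, Real.exp (2 * (V e - m)) ∂ν ≤ Real.exp (2 * c ^ 2) := by
    have h := (hasSubgaussianMGF_of_mem_Icc (μ := ν) hV.aemeasurable (a := -c) (b := c)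
      (Filter.Eventually.of_forall fun e => abs_le.1 (hVc e))).mgf_le 2
    refine h.trans_eq ?_
    congr 1
    rw [NNReal.coe_pow, NNReal.coe_div, coe_nnnorm, Real.norm_eq_abs, div_pow, sq_abs]
    push_cast
    ring
  have hmc : |m| ≤ c := abs_integral_le_of_abs_le hVc
  have hi1 : Integrable (fun e => Real.exp (2 * U e)) ν :=
    integrable_of_abs_le (by fun_prop) (K := Real.exp (2 * K)) fun e => by
      rw [Real.abs_exp]
      exact Real.exp_le_exp.2 (by linarith [(abs_le.1 (hUK e)).2])
  have hi2 : Integrable (fun e => Real.exp (2 * (V e - m))) ν :=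
    integrable_of_abs_le (by fun_prop) (K := Real.exp (2 * (c + c))) fun e => by
      rw [Real.abs_exp]
      exact Real.exp_le_exp.2 (by linarith [(abs_le.1 (hVc e)).2, (abs_le.1 hmc).1])
  have hUV : ∀ e, |U e + V e| ≤ K + c := fun e =>
    (abs_add_le _ _).trans (add_le_add (hUK e) (hVc e))
  have hi3 : Integrable (fun e => Real.exp (U e + V e)) ν :=
    integrable_of_abs_le (by fun_prop) (K := Real.exp (K + c)) fun e => by
      rw [Real.abs_exp]
      exact Real.exp_le_exp.2 (abs_le.1 (hUV e)).2
  have hpos : 0 < ∫ e, Real.exp (U e + V e) ∂ν :=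
    (Real.exp_pos _).trans_le (exp_neg_le_integral_exp (by fun_prop) hUV)
  -- With this shift `E exp (2(V - w)) ≤ 1`, so AM-GM applied to `exp U * exp (V - w)` leaves only
  -- the exponential moment of `2U`.
  set w := m + c ^ 2
  have hw : ∫ e, Real.exp (U e + V e) ∂ν
      ≤ Real.exp w * ((1 / 2) * ∫ e, Real.exp (2 * U e) ∂ν + 1 / 2) := by
    have hpt : ∀ e, Real.exp (U e + V e) ≤ Real.exp w * ((1 / 2) * Real.exp (2 * U e)
        + (1 / 2) * (Real.exp (-(2 * c ^ 2)) * Real.exp (2 * (V e - m)))) := by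
      intro e
      have e1 : Real.exp (U e + V e) = Real.exp w * (Real.exp (U e) * Real.exp (V e - w)) := by
        rw [← Real.exp_add, ← Real.exp_add]
        congr 1
        ring
      have e2 : Real.exp (-(2 * c ^ 2)) * Real.exp (2 * (V e - m)) = Real.exp (V e - w) ^ 2 := by
        rw [← Real.exp_add, ← Real.exp_nat_mul]
        congr 1
        simp only [w]
        push_cast
        ring
      have e3 : Real.exp (2 * U e) = Real.exp (U e) ^ 2 := by
        rw [← Real.exp_nat_mul]
        norm_num
      rw [e1, e2, e3]
      apply mul_le_mul_of_nonneg_left _ (Real.exp_pos _).le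
      nlinarith [sq_nonneg (Real.exp (U e) - Real.exp (V e - w))]
    calc ∫ e, Real.exp (U e + V e) ∂ν
        ≤ ∫ e, Real.exp w * ((1 / 2) * Real.exp (2 * U e)
          + (1 / 2) * (Real.exp (-(2 * c ^ 2)) * Real.exp (2 * (V e - m)))) ∂ν :=
          integral_mono hi3 (((hi1.const_mul _).add ((hi2.const_mul _).const_mul _)).const_mul _)
            hpt
      _ = Real.exp w * ((1 / 2) * ∫ e, Real.exp (2 * U e) ∂ν
          + (1 / 2) * (Real.exp (-(2 * c ^ 2)) * ∫ e, Real.exp (2 * (V e - m)) ∂ν)) := by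
          rw [integral_const_mul, integral_add (hi1.const_mul _) ((hi2.const_mul _).const_mul _),
            integral_const_mul, integral_const_mul, integral_const_mul]
      _ ≤ Real.exp w * ((1 / 2) * ∫ e, Real.exp (2 * U e) ∂ν + 1 / 2) := by
          apply mul_le_mul_of_nonneg_left _ (Real.exp_pos _).le
          have : Real.exp (-(2 * c ^ 2)) * ∫ e, Real.exp (2 * (V e - m)) ∂ν ≤ 1 := by
            calc _ ≤ Real.exp (-(2 * c ^ 2)) * Real.exp (2 * c ^ 2) :=
                  mul_le_mul_of_nonneg_left hmgf (Real.exp_pos _).le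
              _ = 1 := by rw [← Real.exp_add]; simp
          linarith
  have hA : 0 ≤ ∫ e, Real.exp (2 * U e) ∂ν := integral_nonneg fun e => (Real.exp_pos _).le
  have h1 := Real.log_le_log hpos hw
  rw [Real.log_mul (Real.exp_ne_zero _) (by positivity), Real.log_exp] at h1
  have h2 := Real.log_le_sub_one_of_pos
    (show 0 < (1 / 2) * ∫ e, Real.exp (2 * U e) ∂ν + 1 / 2 by positivity)
  simp only [w] at h1
  linarith

end Bounded

/-! ### Conditional laws -/

section CondLaw

variable {Ω 𝓗 𝓩 : Type*} [MeasurableSpace Ω] [MeasurableSpace 𝓗] [MeasurableSpace 𝓩]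
  {Z : Ω → 𝓩} {H : Ω → 𝓗} {κ : 𝓗 → Measure 𝓩} {Pr : Measure Ω}

lemma HasCondLaw.aemeasurable (h : HasCondLaw Z H κ Pr) : AEMeasurable (fun ω => (H ω, Z ω)) Pr :=
  let ⟨_, _, hK⟩ := h
  HasLaw.aemeasurable hK

/-- A bound for conditional expectations is a bound for expectations. -/
lemma HasCondLaw.integral_le [IsProbabilityMeasure Pr] (h : HasCondLaw Z H κ Pr)
    (hκ : ∀ z, IsProbabilityMeasure (κ z)) {f : 𝓗 × 𝓩 → ℝ} {g : 𝓗 → ℝ} (hf : Measurable f)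
    (hg : Measurable g) {K : ℝ} (hfK : ∀ z, |f z| ≤ K) (hgK : ∀ z, |g z| ≤ K)
    (hfg : ∀ z, ∫ w, f (z, w) ∂κ z ≤ g z) :
    ∫ ω, f (H ω, Z ω) ∂Pr ≤ ∫ ω, g (H ω) ∂Pr := by
  obtain ⟨k, hk, hd⟩ := h
  have hH : AEMeasurable H Pr := (HasLaw.aemeasurable hd).fst
  have : IsMarkovKernel k := ⟨fun z => by rw [hk]; exact hκ z⟩
  have : IsProbabilityMeasure (Pr.map H) := Measure.isProbabilityMeasure_map hH
  have hmap : Pr.map (fun ω => (H ω, Z ω)) = Pr.map H ⊗ₘ k := hd.map_eq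
  have hfi : Integrable f (Pr.map H ⊗ₘ k) := integrable_of_abs_le hf hfK
  calc ∫ ω, f (H ω, Z ω) ∂Pr = ∫ z, f z ∂(Pr.map H ⊗ₘ k) := by
        rw [← hmap, integral_map (HasLaw.aemeasurable hd) hf.aestronglyMeasurable]
    _ = ∫ z, ∫ w, f (z, w) ∂k z ∂(Pr.map H) := Measure.integral_compProd hfi
    _ ≤ ∫ z, g z ∂(Pr.map H) :=
        integral_mono (integrable_of_abs_le hf.stronglyMeasurable.integral_kernel_prod_right'.measurable
          fun z => abs_integral_le_of_abs_le fun w => hfK (z, w)) (integrable_of_abs_le hg hgK) fun z => by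
          simpa only [hk] using hfg z
    _ = ∫ ω, g (H ω) ∂Pr := integral_map hH hg.aestronglyMeasurable

end CondLaw

/-! ### The preference model -/

section Preference

variable {Θ X A : Type*}

/-- The logistic loss is the negative log-likelihood of the preference, so differences of losses are
log-likelihood ratios. -/
lemma btlProb_eq (r : Θ → X → A → ℝ) (θs : Θ) (x : X) (a : Fin 2 → A) :
    btlProb r θs x a = Real.exp (-logLoss (rewardDiff r θs x (a 0) (a 1))) := by
  rw [exp_neg_logLoss, btlProb, rewardDiff, neg_sub, Real.exp_sub]
  have h1 := Real.exp_pos (r θs x (a 0))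
  have h2 := Real.exp_pos (r θs x (a 1))
  field_simp

lemma one_sub_btlProb_eq (r : Θ → X → A → ℝ) (θs : Θ) (x : X) (a : Fin 2 → A) :
    1 - btlProb r θs x a = Real.exp (-logLoss (-rewardDiff r θs x (a 0) (a 1))) := by
  rw [exp_neg_logLoss, btlProb, rewardDiff, neg_neg, Real.exp_sub]
  have h1 := Real.exp_pos (r θs x (a 0))
  have h2 := Real.exp_pos (r θs x (a 1))
  field_simp
  ring

lemma isProbabilityMeasure_btl (r : Θ → X → A → ℝ) (θs : Θ) (x : X) (a : Fin 2 → A) :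
    IsProbabilityMeasure (btl r θs x a) := by
  refine ⟨?_⟩
  have h1 : 0 ≤ btlProb r θs x a := by rw [btlProb_eq]; positivity
  have h2 : 0 ≤ 1 - btlProb r θs x a := by rw [one_sub_btlProb_eq]; positivity
  simp only [btl, Measure.coe_add, Measure.coe_smul, Pi.add_apply, Pi.smul_apply, measure_univ,
    smul_eq_mul, mul_one]
  rw [← ENNReal.ofReal_add h1 h2]
  simp

lemma integral_btl (r : Θ → X → A → ℝ) (θs : Θ) (x : X) (a : Fin 2 → A) (f : Bool → ℝ) :
    ∫ y, f y ∂btl r θs x a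
      = Real.exp (-logLoss (rewardDiff r θs x (a 0) (a 1))) * f true
        + Real.exp (-logLoss (-rewardDiff r θs x (a 0) (a 1))) * f false := by
  have hi : ∀ (c : ENNReal) (b : Bool), c ≠ ⊤ → Integrable f (c • Measure.dirac b) :=
    fun c b hc => ((integrable_dirac (by simp)).smul_measure hc)
  rw [btl, integral_add_measure (hi _ _ ENNReal.ofReal_ne_top) (hi _ _ ENNReal.ofReal_ne_top),
    integral_smul_measure, integral_smul_measure, integral_dirac, integral_dirac,
    one_sub_btlProb_eq, btlProb_eq, ENNReal.toReal_ofReal (Real.exp_pos _).le,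
    ENNReal.toReal_ofReal (Real.exp_pos _).le, smul_eq_mul, smul_eq_mul]

end Preference

/-! ### The reward class -/

section Rewards

variable {Θ X S A : Type*} [MeasurableSpace Θ] [MeasurableSpace X] [MeasurableSpace S]
  [MeasurableSpace A]

/-- A measurable class of rewards bounded by `B`, whose maximal values over the (nonempty) action
spaces are measurable. -/
structure IsRewardClass (r : Θ → X → A → ℝ) (act : S → Set A) (B : ℝ) : Prop where
  measurable : Measurable fun z : Θ × X × A => r z.1 z.2.1 z.2.2
  bound : ∀ θ x a, |r θ x a| ≤ B
  measurable_iSup : Measurable fun z : Θ × X × S => ⨆ b : act z.2.2, r z.1 z.2.1 b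
  nonempty : ∀ s, (act s).Nonempty

/-- `max_b Δr_θ(x, b, a) - max_b Δr_*(x, b, a)`. -/
noncomputable def feelGoodGap (r : Θ → X → A → ℝ) (act : S → Set A) (θs θ : Θ) (x : X) (s : S)
    (a : A) : ℝ :=
  ((⨆ b : act s, r θ x b) - r θ x a) - ((⨆ b : act s, r θs x b) - r θs x a)

/-- The excess of the Feel-Good likelihood function over its value at the true parameter. -/
noncomputable def lossGap (r : Θ → X → A → ℝ) (act : S → Set A) (η μ : ℝ) (θs : Θ) (j : Fin 2)
    (θ : Θ) (o : Obs X S A) : ℝ :=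
  feelGoodLoss r act η μ j θ o - feelGoodLoss r act η μ j θs o

namespace IsRewardClass

variable {r : Θ → X → A → ℝ} {act : S → Set A} {B : ℝ} (hR : IsRewardClass r act B)
include hR

lemma bddAbove (θ : Θ) (x : X) (s : S) : BddAbove (Set.range fun b : act s => r θ x b) :=
  ⟨B, by rintro _ ⟨b, rfl⟩; exact (abs_le.1 (hR.bound θ x b)).2⟩

lemma iSup_rewardDiff (θ : Θ) (x : X) (s : S) (a : A) :
    ⨆ b : act s, rewardDiff r θ x b a = (⨆ b : act s, r θ x b) - r θ x a := by
  have := (hR.nonempty s).to_subtype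
  exact (ciSup_sub (hR.bddAbove θ x s) _).symm

lemma abs_iSup_le (θ : Θ) (x : X) (s : S) : |⨆ b : act s, r θ x b| ≤ B := by
  have := (hR.nonempty s).to_subtype
  obtain ⟨a, ha⟩ := hR.nonempty s
  rw [abs_le]
  constructor
  · exact (abs_le.1 (hR.bound θ x a)).1.trans (le_ciSup (hR.bddAbove θ x s) ⟨a, ha⟩)
  · exact ciSup_le fun b => (abs_le.1 (hR.bound θ x b)).2

lemma abs_iSup_sub_iSup_le {θ θ' : Θ} {ε : ℝ} (h : ∀ x a, |r θ x a - r θ' x a| ≤ ε) (x : X)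
    (s : S) : |(⨆ b : act s, r θ x b) - ⨆ b : act s, r θ' x b| ≤ ε := by
  have := (hR.nonempty s).to_subtype
  have key : ∀ θ θ' : Θ, (∀ x a, |r θ x a - r θ' x a| ≤ ε) →
      (⨆ b : act s, r θ x b) ≤ (⨆ b : act s, r θ' x b) + ε := fun θ θ' h =>
    ciSup_le fun b => by
      have h1 := le_ciSup (hR.bddAbove θ' x s) b
      have h2 := (abs_le.1 (h x b)).2
      linarith
  rw [abs_le]
  have h1 := key θ θ' h
  have h2 := key θ' θ fun x a => by rw [abs_sub_comm]; exact h x a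
  constructor <;> linarith

lemma abs_sub_le (θ θ' : Θ) (x : X) (a : A) : |r θ x a - r θ' x a| ≤ 2 * B := by
  have h1 := abs_le.1 (hR.bound θ x a)
  have h2 := abs_le.1 (hR.bound θ' x a)
  rw [abs_le]
  constructor <;> linarith

lemma abs_rewardDiff_le (θ : Θ) (x : X) (a b : A) : |rewardDiff r θ x a b| ≤ 2 * B := by
  have h1 := abs_le.1 (hR.bound θ x a)
  have h2 := abs_le.1 (hR.bound θ x b)
  rw [abs_le, rewardDiff]
  constructor <;> linarith

lemma sq_rewardDiff_sub_le (θ θ' : Θ) (x : X) (a b : A) :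
    |(rewardDiff r θ x a b - rewardDiff r θ' x a b) ^ 2| ≤ 16 * B ^ 2 := by
  have h1 := abs_le.1 (hR.abs_rewardDiff_le θ x a b)
  have h2 := abs_le.1 (hR.abs_rewardDiff_le θ' x a b)
  rw [abs_of_nonneg (sq_nonneg _)]
  nlinarith

lemma abs_feelGoodGap_le {θ θs : Θ} {ε : ℝ} (h : ∀ x a, |r θ x a - r θs x a| ≤ ε) (x : X)
    (s : S) (a : A) : |feelGoodGap r act θs θ x s a| ≤ 2 * ε := by
  have h1 := abs_le.1 (hR.abs_iSup_sub_iSup_le h x s)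
  have h2 := abs_le.1 (h x a)
  rw [abs_le, feelGoodGap]
  constructor <;> linarith

lemma lossGap_eq (η μ : ℝ) (θs : Θ) (j : Fin 2) (θ : Θ) (x : X) (s : S) (a : Fin 2 → A)
    (y : Bool) :
    lossGap r act η μ θs j θ (x, s, a, y) =
      η * (logLoss (sgn y * rewardDiff r θ x (a 0) (a 1))
        - logLoss (sgn y * rewardDiff r θs x (a 0) (a 1)))
      - μ * feelGoodGap r act θs θ x s (a (1 - j)) := by
  simp only [lossGap, feelGoodLoss, hR.iSup_rewardDiff, feelGoodGap]
  ring

/-- Used at two scales: `ε = 2B` for integrability, and `ε = 2 / T` on the small ball around the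
true parameter. It rests on the loss being 1-Lipschitz. -/
lemma abs_lossGap_le {η μ : ℝ} (hη : 0 ≤ η) (hμ : 0 ≤ μ) {θ θs : Θ} {ε : ℝ}
    (h : ∀ x a, |r θ x a - r θs x a| ≤ ε) (j : Fin 2) (o : Obs X S A) :
    |lossGap r act η μ θs j θ o| ≤ (η + μ) * (2 * ε) := by
  obtain ⟨x, s, a, y⟩ := o
  rw [hR.lossGap_eq]
  have h1 := hR.abs_feelGoodGap_le h x s (a (1 - j))
  have h2 : |logLoss (sgn y * rewardDiff r θ x (a 0) (a 1))
      - logLoss (sgn y * rewardDiff r θs x (a 0) (a 1))| ≤ 2 * ε := by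
    refine (abs_logLoss_sub_le _ _).trans ?_
    rw [← mul_sub, abs_mul]
    have hy : |sgn y| = 1 := by cases y <;> simp [sgn]
    have h3 := abs_le.1 (h x (a 0))
    have h4 := abs_le.1 (h x (a 1))
    rw [hy, one_mul, abs_le, rewardDiff, rewardDiff]
    constructor <;> linarith
  refine (abs_sub _ _).trans ?_
  rw [abs_mul, abs_mul, abs_of_nonneg hη, abs_of_nonneg hμ, add_mul]
  exact add_le_add (mul_le_mul_of_nonneg_left h2 hη) (mul_le_mul_of_nonneg_left h1 hμ)

lemma measurable_rewardDiff : Measurable fun z : Θ × X × A × A =>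
    rewardDiff r z.1 z.2.1 z.2.2.1 z.2.2.2 := by
  unfold rewardDiff
  have h1 : Measurable fun z : Θ × X × A × A => r z.1 z.2.1 z.2.2.1 :=
    hR.measurable.comp (g := fun z : Θ × X × A => r z.1 z.2.1 z.2.2)
      (f := fun z : Θ × X × A × A => (z.1, z.2.1, z.2.2.1)) (by fun_prop)
  have h2 : Measurable fun z : Θ × X × A × A => r z.1 z.2.1 z.2.2.2 :=
    hR.measurable.comp (g := fun z : Θ × X × A => r z.1 z.2.1 z.2.2)
      (f := fun z : Θ × X × A × A => (z.1, z.2.1, z.2.2.2)) (by fun_prop)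
  exact h1.sub h2

lemma measurable_regret (θs : Θ) : Measurable fun z : X × S × A =>
    (⨆ b : act z.2.1, r θs z.1 b) - r θs z.1 z.2.2 :=
  (hR.measurable_iSup.comp (f := fun z : X × S × A => (θs, z.1, z.2.1)) (by fun_prop)).sub
    (hR.measurable.comp (f := fun z : X × S × A => (θs, z.1, z.2.2)) (by fun_prop))

lemma abs_regret_le (θs : Θ) (x : X) (s : S) (a : A) :
    |(⨆ b : act s, r θs x b) - r θs x a| ≤ 2 * B := by
  have h1 := abs_le.1 (hR.abs_iSup_le θs x s)
  have h2 := abs_le.1 (hR.bound θs x a)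
  rw [abs_le]
  constructor <;> linarith

lemma measurable_feelGoodGap (θs : Θ) : Measurable fun z : Θ × X × S × A =>
    feelGoodGap r act θs z.1 z.2.1 z.2.2.1 z.2.2.2 := by
  unfold feelGoodGap
  exact ((hR.measurable_iSup.comp (f := fun z : Θ × X × S × A => (z.1, z.2.1, z.2.2.1))
    (by fun_prop)).sub (hR.measurable.comp
      (f := fun z : Θ × X × S × A => (z.1, z.2.1, z.2.2.2)) (by fun_prop))).sub
    ((hR.measurable_regret θs).comp (measurable_snd (α := Θ)))

lemma measurable_feelGoodLoss (η μ : ℝ) (j : Fin 2) : Measurable fun z : Θ × Obs X S A =>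
    feelGoodLoss r act η μ j z.1 z.2 := by
  simp only [feelGoodLoss, hR.iSup_rewardDiff]
  have hs : Measurable sgn := measurable_of_countable _
  have h1 : Measurable fun z : Θ × Obs X S A =>
      rewardDiff r z.1 z.2.1 (z.2.2.2.1 0) (z.2.2.2.1 1) :=
    hR.measurable_rewardDiff.comp (f := fun z : Θ × Obs X S A =>
      (z.1, z.2.1, z.2.2.2.1 0, z.2.2.2.1 1)) (by fun_prop)
  have h2 : Measurable fun z : Θ × Obs X S A => ⨆ b : act z.2.2.1, r z.1 z.2.1 b :=
    hR.measurable_iSup.comp (f := fun z : Θ × Obs X S A => (z.1, z.2.1, z.2.2.1)) (by fun_prop)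
  have h3 : Measurable fun z : Θ × Obs X S A => r z.1 z.2.1 (z.2.2.2.1 (1 - j)) :=
    hR.measurable.comp (f := fun z : Θ × Obs X S A => (z.1, z.2.1, z.2.2.2.1 (1 - j)))
      (by fun_prop)
  have h4 : Measurable fun z : Θ × Obs X S A => sgn z.2.2.2.2 := hs.comp (by fun_prop)
  exact ((measurable_logLoss.comp (h4.mul h1)).const_mul η).sub ((h2.sub h3).const_mul μ)

lemma measurable_lossGap (η μ : ℝ) (θs : Θ) (j : Fin 2) : Measurable fun z : Θ × Obs X S A =>
    lossGap r act η μ θs j z.1 z.2 :=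
  (hR.measurable_feelGoodLoss η μ j).sub ((hR.measurable_feelGoodLoss η μ j).comp
    (f := fun z : Θ × Obs X S A => (θs, z.2)) (by fun_prop))

end IsRewardClass

/-! ### One round, given the arms -/

/-- The expected decrease of the log-partition function in one round, given the arms. -/
lemma IsRewardClass.integral_btl_log_le {r : Θ → X → A → ℝ} {act : S → Set A} {B : ℝ}
    (hR : IsRewardClass r act B) {μ : ℝ} (hμ : 0 ≤ μ) (θs : Θ) (j : Fin 2) (x : X) (s : S)
    (a : Fin 2 → A) (ν : Measure Θ) [IsProbabilityMeasure ν] :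
    ∫ y, Real.log (∫ θ, Real.exp (-lossGap r act (1 / 4) μ θs j θ (x, s, a, y)) ∂ν) ∂btl r θs x a
      ≤ -(Real.exp (-(2 * B)) / 64)
          * ∫ θ, (rewardDiff r θ x (a 0) (a 1) - rewardDiff r θs x (a 0) (a 1)) ^ 2 ∂ν
        + μ * ∫ θ, feelGoodGap r act θs θ x s (a (1 - j)) ∂ν + 16 * μ ^ 2 * B ^ 2 := by
  set v := rewardDiff r θs x (a 0) (a 1) with hv
  set u : Θ → ℝ := fun θ => rewardDiff r θ x (a 0) (a 1) with hu
  have hum : Measurable u := hR.measurable_rewardDiff.comp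
    (f := fun θ : Θ => (θ, x, a 0, a 1)) (by fun_prop)
  have hub : ∀ θ, |u θ| ≤ 2 * B := fun θ => hR.abs_rewardDiff_le θ x _ _
  have hvb : |v| ≤ 2 * B := hR.abs_rewardDiff_le θs x _ _
  set g : Θ → ℝ := fun θ => feelGoodGap r act θs θ x s (a (1 - j)) with hg
  have hgm : Measurable g := (hR.measurable_feelGoodGap θs).comp
    (f := fun θ : Θ => (θ, x, s, a (1 - j))) (by fun_prop)
  have hgb : ∀ θ, |g θ| ≤ 4 * B := fun θ =>
    (hR.abs_feelGoodGap_le (hR.abs_sub_le θ θs) x s _).trans (by linarith)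
  -- the half log-likelihood ratios
  set D : Bool → Θ → ℝ := fun y θ => logLoss (sgn y * u θ) - logLoss (sgn y * v) with hD
  have hDm : ∀ y, Measurable (D y) := fun y =>
    (measurable_logLoss.comp (hum.const_mul _)).sub_const _
  have hDb : ∀ y θ, |D y θ| ≤ 4 * B := by
    intro y θ
    refine (abs_logLoss_sub_le _ _).trans ?_
    rw [← mul_sub, abs_mul]
    have hy : |sgn y| = 1 := by cases y <;> simp [sgn]
    have h1 := abs_le.1 (hub θ)
    have h2 := abs_le.1 hvb
    rw [hy, one_mul, abs_le]
    constructor <;> linarith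
  have hlog : ∀ y, Real.log (∫ θ, Real.exp (-lossGap r act (1 / 4) μ θs j θ (x, s, a, y)) ∂ν)
      ≤ (1 / 2) * (∫ θ, Real.exp (-(1 / 2) * D y θ) ∂ν - 1) + μ * ∫ θ, g θ ∂ν
        + 16 * μ ^ 2 * B ^ 2 := by
    intro y
    -- Doubling the factor `η = 1/4` yields `exp (-D / 2)`, the square root of the likelihood ratio.
    have h := log_integral_exp_add_le (ν := ν) (U := fun θ => -(1 / 4) * D y θ)
      (V := fun θ => μ * g θ) ((hDm y).const_mul _) (hgm.const_mul _) (K := B) (c := μ * (4 * B))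
      (fun θ => by
        rw [abs_mul, abs_neg, abs_of_pos (by norm_num)]
        linarith [hDb y θ])
      (fun θ => by
        rw [abs_mul, abs_of_nonneg hμ]
        exact mul_le_mul_of_nonneg_left (hgb θ) hμ)
    have e1 : ∀ θ, -lossGap r act (1 / 4) μ θs j θ (x, s, a, y)
        = -(1 / 4) * D y θ + μ * g θ := by
      intro θ
      rw [hR.lossGap_eq]
      simp only [hD, hu, hv, hg]
      ring
    have e2 : ∀ θ, 2 * (-(1 / 4) * D y θ) = -(1 / 2) * D y θ := fun θ => by ring
    simp only [e1]
    simp only [e2, integral_const_mul] at h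
    refine h.trans_eq ?_
    ring
  rw [integral_btl, ← hv]
  set P := Real.exp (-logLoss v)
  set N := Real.exp (-logLoss (-v))
  have hPN : P + N = 1 := by
    have h1 := btlProb_eq r θs x a
    have h2 := one_sub_btlProb_eq r θs x a
    simp only [P, N, hv]
    linarith
  have hi : ∀ y, Integrable (fun θ => Real.exp (-(1 / 2) * D y θ)) ν := fun y =>
    integrable_of_abs_le ((hDm y).const_mul _).exp (K := Real.exp (2 * B)) fun θ => by
      rw [Real.abs_exp]
      exact Real.exp_le_exp.2 (by linarith [(abs_le.1 (hDb y θ)).1])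
  have hi2 : Integrable (fun θ => (u θ - v) ^ 2) ν :=
    integrable_of_abs_le ((hum.sub_const v).pow_const 2) fun θ =>
      hR.sq_rewardDiff_sub_le θ θs x (a 0) (a 1)
  -- The true likelihood times the square root of the likelihood ratio is the geometric mean of the
  -- two likelihoods. Summed over both preferences this is the Hellinger affinity.
  have hA : P * ∫ θ, Real.exp (-(1 / 2) * D true θ) ∂ν
      + N * ∫ θ, Real.exp (-(1 / 2) * D false θ) ∂ν
      ≤ 1 - Real.exp (-(2 * B)) / 32 * ∫ θ, (u θ - v) ^ 2 ∂ν := by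
    rw [← integral_const_mul, ← integral_const_mul, ← integral_const_mul,
      ← integral_add ((hi _).const_mul _) ((hi _).const_mul _)]
    have : 1 - ∫ θ, Real.exp (-(2 * B)) / 32 * (u θ - v) ^ 2 ∂ν
        = ∫ θ, (1 - Real.exp (-(2 * B)) / 32 * (u θ - v) ^ 2) ∂ν := by
      rw [integral_sub (integrable_const _) (hi2.const_mul _)]
      simp
    rw [this]
    refine integral_mono (((hi _).const_mul _).add ((hi _).const_mul _))
      ((integrable_const _).sub (hi2.const_mul _)) fun θ => ?_
    refine le_trans (le_of_eq ?_) (hellinger_affinity_le (hub θ) hvb)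
    simp only [P, N, hD, sgn, if_true, one_mul, ← Real.exp_add]
    simp only [Bool.false_eq_true, if_false, neg_one_mul]
    congr 2 <;> ring
  have h1 := mul_le_mul_of_nonneg_left (hlog true) (Real.exp_pos (-logLoss v)).le
  have h2 := mul_le_mul_of_nonneg_left (hlog false) (Real.exp_pos (-logLoss (-v))).le
  have hN : N = 1 - P := by linarith
  refine (add_le_add h1 h2).trans ?_
  change P * _ + N * _ ≤ _
  rw [hN] at hA ⊢
  linarith

/-! ### Decoupling -/

/-- One-round decoupling for one of the two arms: `ν` is the law of the parameter that chooses the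
arm `own`, and `ν'` that of the independent parameter that chooses the arm `oth`. -/
lemma IsRewardClass.integral_regret_le {r : Θ → X → A → ℝ} {act : S → Set A} {B : ℝ}
    (hR : IsRewardClass r act B) {θs : Θ} {dc : ℝ} (hdc : IsDecouplingCoeff r θs dc) {lam : ℝ}
    (hlam : 0 < lam) (x : X) (s : S) (ν ν' : Measure Θ) [IsProbabilityMeasure ν]
    [IsProbabilityMeasure ν'] {own oth : Θ → A} (hown : Measurable own) (hoth : Measurable oth)
    (hmax : ∀ θ, r θ x (own θ) = ⨆ b : act s, r θ x b) :
    ∫ w, ((⨆ b : act s, r θs x b) - r θs x (own w.1)) ∂ν.prod ν'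
      ≤ lam * dc
        + 1 / (4 * lam) * ∫ w, ∫ θ, (rewardDiff r θ x (own w.1) (oth w.2)
            - rewardDiff r θs x (own w.1) (oth w.2)) ^ 2 ∂ν ∂ν.prod ν'
        - ∫ w, ∫ θ, feelGoodGap r act θs θ x s (oth w.2) ∂ν ∂ν.prod ν' := by
  have hφ : Measurable fun w : Θ × Θ => (w.1, own w.1, oth w.2) := by fun_prop
  -- The joint law of the parameter and the two arms. The decoupling inequality replaces it on the
  -- right by the product of its marginals, that is, by a fresh parameter drawn from `ν`.
  set P := (ν.prod ν').map fun w : Θ × Θ => (w.1, own w.1, oth w.2) with hP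
  have hPp : IsProbabilityMeasure P := Measure.isProbabilityMeasure_map hφ.aemeasurable
  have hrm : Measurable fun z : Θ × A × A => rewardDiff r z.1 x z.2.1 z.2.2 :=
    hR.measurable_rewardDiff.comp (f := fun z : Θ × A × A => (z.1, x, z.2)) (by fun_prop)
  have hrs : Measurable fun b : A × A => rewardDiff r θs x b.1 b.2 :=
    hR.measurable_rewardDiff.comp (f := fun z : A × A => (θs, x, z)) (by fun_prop)
  have hdiff : Measurable fun z : Θ × A × A =>
      rewardDiff r z.1 x z.2.1 z.2.2 - rewardDiff r θs x z.2.1 z.2.2 :=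
    hrm.sub (hrs.comp measurable_snd)
  have hdb : ∀ θ (a b : A), |rewardDiff r θ x a b - rewardDiff r θs x a b| ≤ 4 * B := by
    intro θ a b
    have h1 := abs_le.1 (hR.abs_rewardDiff_le θ x a b)
    have h2 := abs_le.1 (hR.abs_rewardDiff_le θs x a b)
    rw [abs_le]
    constructor <;> linarith
  have hfst : P.fst = ν := by
    rw [hP, Measure.fst_map_prodMk (by fun_prop)]
    exact (measurePreserving_fst (μ := ν) (ν := ν')).map_eq
  have hsnd : P.snd = (ν.prod ν').map fun w : Θ × Θ => (own w.1, oth w.2) := by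
    rw [hP, Measure.snd_map_prodMk (by fun_prop)]
  have hD := hdc lam hlam x P hPp
  rw [hfst, hsnd, hP, integral_map hφ.aemeasurable hdiff.aestronglyMeasurable] at hD
  have hinner : ∀ θ, ∫ b, (rewardDiff r θ x b.1 b.2 - rewardDiff r θs x b.1 b.2) ^ 2
        ∂(ν.prod ν').map (fun w : Θ × Θ => (own w.1, oth w.2))
      = ∫ w, (rewardDiff r θ x (own w.1) (oth w.2)
          - rewardDiff r θs x (own w.1) (oth w.2)) ^ 2 ∂ν.prod ν' := fun θ =>
    integral_map (f := fun b : A × A => (rewardDiff r θ x b.1 b.2 - rewardDiff r θs x b.1 b.2) ^ 2)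
      (by fun_prop)
      ((hdiff.comp (f := fun b : A × A => (θ, b)) (by fun_prop)).pow_const 2).aestronglyMeasurable
  simp only [hinner] at hD
  have hsq : Measurable fun z : Θ × Θ × Θ => (rewardDiff r z.1 x (own z.2.1) (oth z.2.2)
      - rewardDiff r θs x (own z.2.1) (oth z.2.2)) ^ 2 :=
    (hdiff.comp (f := fun z : Θ × Θ × Θ => (z.1, own z.2.1, oth z.2.2)) (by fun_prop)).pow_const 2
  rw [integral_integral_swap (f := fun θ (w : Θ × Θ) => (rewardDiff r θ x (own w.1) (oth w.2)
      - rewardDiff r θs x (own w.1) (oth w.2)) ^ 2)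
    (integrable_of_abs_le hsq fun z => hR.sq_rewardDiff_sub_le z.1 θs x _ _)] at hD
  -- the Feel-Good term
  have hgm : Measurable fun w : Θ × Θ => feelGoodGap r act θs w.1 x s (oth w.2) :=
    (hR.measurable_feelGoodGap θs).comp (f := fun w : Θ × Θ => (w.1, x, s, oth w.2))
      (by fun_prop)
  have hgi : Integrable (fun w : Θ × Θ => feelGoodGap r act θs w.1 x s (oth w.2)) (ν.prod ν') :=
    integrable_of_abs_le hgm fun w => hR.abs_feelGoodGap_le (hR.abs_sub_le w.1 θs) x s _
  -- The gap involves only the opposing arm, which is independent of the first parameter. A fresh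
  -- draw therefore gives the same mean.
  have hfg : ∫ w, ∫ θ, feelGoodGap r act θs θ x s (oth w.2) ∂ν ∂ν.prod ν'
      = ∫ w, feelGoodGap r act θs w.1 x s (oth w.2) ∂ν.prod ν' := by
    rw [integral_prod_symm _ hgi]
    have := integral_fun_snd (μ := ν) (ν := ν')
      (fun θ' => ∫ θ, feelGoodGap r act θs θ x s (oth θ') ∂ν)
    simpa using this
  have hdi : Integrable (fun w : Θ × Θ => rewardDiff r w.1 x (own w.1) (oth w.2)
      - rewardDiff r θs x (own w.1) (oth w.2)) (ν.prod ν') :=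
    integrable_of_abs_le (hdiff.comp hφ) fun w => hdb _ _ _
  -- As `own` maximizes the sampled reward, the supremum of that reward inside the gap cancels.
  have hreg : ∫ w, ((⨆ b : act s, r θs x b) - r θs x (own w.1)) ∂ν.prod ν'
      = ∫ w : Θ × Θ, (rewardDiff r w.1 x (own w.1) (oth w.2)
          - rewardDiff r θs x (own w.1) (oth w.2)) ∂ν.prod ν'
        - ∫ w, feelGoodGap r act θs w.1 x s (oth w.2) ∂ν.prod ν' := by
    rw [← integral_sub hdi hgi]
    congr 1
    ext w
    rw [feelGoodGap, ← hmax w.1, rewardDiff, rewardDiff]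
    ring
  rw [hreg, hfg]
  linarith

/-- One-round decoupling for the two arms at once. -/
lemma IsRewardClass.integral_pair_regret_le {r : Θ → X → A → ℝ} {act : S → Set A} {B : ℝ}
    (hR : IsRewardClass r act B) {θs : Θ} {dc : ℝ} (hdc : IsDecouplingCoeff r θs dc) {lam : ℝ}
    (hlam : 0 < lam) (x : X) (s : S) (ν : Fin 2 → Measure Θ) [∀ j, IsProbabilityMeasure (ν j)]
    {sel : Fin 2 → Θ → A} (hsel : ∀ j, Measurable (sel j))
    (hmax : ∀ j θ, r θ x (sel j θ) = ⨆ b : act s, r θ x b) (j : Fin 2) :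
    ∫ w, ((⨆ b : act s, r θs x b) - r θs x (![sel 0 w.1, sel 1 w.2] j)) ∂(ν 0).prod (ν 1)
      ≤ lam * dc
        + 1 / (4 * lam) * ∫ w, ∫ θ, (rewardDiff r θ x (sel 0 w.1) (sel 1 w.2)
            - rewardDiff r θs x (sel 0 w.1) (sel 1 w.2)) ^ 2 ∂ν j ∂(ν 0).prod (ν 1)
        - ∫ w, ∫ θ, feelGoodGap r act θs θ x s (![sel 0 w.1, sel 1 w.2] (1 - j)) ∂ν j
            ∂(ν 0).prod (ν 1) := by
  match j with
  | 0 => exact hR.integral_regret_le hdc hlam x s (ν 0) (ν 1) (hsel 0) (hsel 1) (hmax 0)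
  | 1 =>
    have h := hR.integral_regret_le hdc hlam x s (ν 1) (ν 0) (hsel 1) (hsel 0) (hmax 1)
    rw [← integral_prod_swap, ← integral_prod_swap (f := fun w : Θ × Θ => ∫ θ, (rewardDiff r θ x
      (sel 1 w.1) (sel 0 w.2) - rewardDiff r θs x (sel 1 w.1) (sel 0 w.2)) ^ 2 ∂ν 1),
      ← integral_prod_swap (f := fun w : Θ × Θ =>
        ∫ θ, feelGoodGap r act θs θ x s (sel 0 w.2) ∂ν 1)] at h
    refine h.trans_eq ?_
    -- Exchanging the two arms changes the sign of both reward differences, so the square is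
    -- unaffected.
    have hsq : ∀ θ (a b : A), (rewardDiff r θ x b a - rewardDiff r θs x b a) ^ 2
        = (rewardDiff r θ x a b - rewardDiff r θs x a b) ^ 2 := fun θ a b => by
      simp only [rewardDiff]
      ring
    simp only [Prod.fst_swap, Prod.snd_swap, hsq _ (sel 0 _) (sel 1 _)]
    rfl

end Rewards

/-! ### One round -/

section Round

variable {Θ X S A : Type*} [MeasurableSpace Θ] [MeasurableSpace X] [MeasurableSpace S]
  [MeasurableSpace A] {r : Θ → X → A → ℝ} {act : S → Set A} {B : ℝ}

/-- The posterior contracts where the sampled rewards err, and this pays for the regret. The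
preference is averaged out first, given the arms, and then the two sampled parameters, given the
history. What survives the cancellation is of order `μ²`. -/
lemma IsRewardClass.round_bound (hR : IsRewardClass r act B) {θs : Θ} {dc : ℝ}
    (hdc : IsDecouplingCoeff r θs dc) {μ : ℝ} (hμ : 0 < μ)
    {Ω 𝓗 : Type*} [MeasurableSpace Ω] [MeasurableSpace 𝓗] {Pr : Measure Ω}
    [IsProbabilityMeasure Pr] {H : Ω → 𝓗} {x : 𝓗 → X} {s : 𝓗 → S} (hx : Measurable x)
    (hs : Measurable s) (Q : Fin 2 → Kernel 𝓗 Θ) [∀ j, IsMarkovKernel (Q j)]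
    {θ : Fin 2 → Ω → Θ} {a : Fin 2 → Ω → A} {y : Ω → Bool}
    (hθ : HasCondLaw (fun ω => (θ 0 ω, θ 1 ω)) H (fun h => (Q 0 h).prod (Q 1 h)) Pr)
    {rule : Fin 2 → 𝓗 × Θ → A} (hrule : ∀ j, Measurable (rule j))
    (hmax : ∀ j h θ, r θ (x h) (rule j (h, θ)) = ⨆ b : act (s h), r θ (x h) b)
    (ha : ∀ j, ∀ᵐ ω ∂Pr, a j ω = rule j (H ω, θ j ω))
    (hy : HasCondLaw y (fun ω => (H ω, fun j => a j ω)) (fun z => btl r θs (x z.1) z.2) Pr)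
    (j : Fin 2) :
    Integrable (fun ω => (⨆ b : act (s (H ω)), r θs (x (H ω)) b) - r θs (x (H ω)) (a j ω)) Pr ∧
    Integrable (fun ω => Real.log (∫ ϑ, Real.exp (-lossGap r act (1 / 4) μ θs j ϑ
      (x (H ω), s (H ω), fun i => a i ω, y ω)) ∂Q j (H ω))) Pr ∧
    μ * ∫ ω, ((⨆ b : act (s (H ω)), r θs (x (H ω)) b) - r θs (x (H ω)) (a j ω)) ∂Pr
      + ∫ ω, Real.log (∫ ϑ, Real.exp (-lossGap r act (1 / 4) μ θs j ϑ
        (x (H ω), s (H ω), fun i => a i ω, y ω)) ∂Q j (H ω)) ∂Pr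
      ≤ μ * (16 * Real.exp (2 * B) * μ * dc) + 16 * μ ^ 2 * B ^ 2 := by
  -- the regret and the log-partition increment as functions of the round's data
  set R : 𝓗 × (Fin 2 → A) → ℝ := fun z =>
    (⨆ b : act (s z.1), r θs (x z.1) b) - r θs (x z.1) (z.2 j) with hRdef
  have hRm : Measurable R := (hR.measurable_regret θs).comp
    (f := fun z : 𝓗 × (Fin 2 → A) => (x z.1, s z.1, z.2 j)) (by fun_prop)
  have hRb : ∀ z, |R z| ≤ 2 * B := fun z => hR.abs_regret_le θs _ _ _
  set D : (𝓗 × (Fin 2 → A)) × Bool → ℝ := fun z => Real.log (∫ ϑ, Real.exp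
    (-lossGap r act (1 / 4) μ θs j ϑ (x z.1.1, s z.1.1, z.1.2, z.2)) ∂Q j z.1.1) with hDdef
  have hgapb : ∀ ϑ o, |lossGap r act (1 / 4) μ θs j ϑ o| ≤ (1 / 4 + μ) * (4 * B) := fun ϑ o =>
    (hR.abs_lossGap_le (by norm_num) hμ.le (hR.abs_sub_le ϑ θs) j o).trans_eq (by ring)
  have hgapm := hR.measurable_lossGap (1 / 4) μ θs j
  have hDm : Measurable D := by
    have h1 : Measurable fun w : ((𝓗 × (Fin 2 → A)) × Bool) × Θ =>
        Real.exp (-lossGap r act (1 / 4) μ θs j w.2 (x w.1.1.1, s w.1.1.1, w.1.1.2, w.1.2)) :=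
      (hgapm.comp (f := fun w : ((𝓗 × (Fin 2 → A)) × Bool) × Θ =>
        (w.2, x w.1.1.1, s w.1.1.1, w.1.1.2, w.1.2)) (by fun_prop)).neg.exp
    exact (h1.stronglyMeasurable.integral_kernel_prod_right' (κ := (Q j).comap
      (fun z : (𝓗 × (Fin 2 → A)) × Bool => z.1.1) (by fun_prop))).measurable.log
  have hDb : ∀ z, |D z| ≤ (1 / 4 + μ) * (4 * B) := fun z =>
    abs_log_integral_exp_le (hgapm.comp (f := fun ϑ : Θ => (ϑ, x z.1.1, s z.1.1, z.1.2, z.2))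
      (by fun_prop)).neg fun ϑ => by
        rw [Pi.neg_apply, abs_neg]
        exact hgapb _ _
  -- its conditional expectation given the arms is at most the following
  set V : 𝓗 × (Fin 2 → A) → ℝ := fun z => ∫ ϑ, (rewardDiff r ϑ (x z.1) (z.2 0) (z.2 1)
    - rewardDiff r θs (x z.1) (z.2 0) (z.2 1)) ^ 2 ∂Q j z.1 with hVdef
  set W : 𝓗 × (Fin 2 → A) → ℝ := fun z =>
    ∫ ϑ, feelGoodGap r act θs ϑ (x z.1) (s z.1) (z.2 (1 - j)) ∂Q j z.1 with hWdef
  have hVm : Measurable V := by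
    have h1 : Measurable fun w : (𝓗 × (Fin 2 → A)) × Θ =>
        (rewardDiff r w.2 (x w.1.1) (w.1.2 0) (w.1.2 1)
          - rewardDiff r θs (x w.1.1) (w.1.2 0) (w.1.2 1)) ^ 2 :=
      ((hR.measurable_rewardDiff.comp (f := fun w : (𝓗 × (Fin 2 → A)) × Θ =>
        (w.2, x w.1.1, w.1.2 0, w.1.2 1)) (by fun_prop)).sub
        (hR.measurable_rewardDiff.comp (f := fun w : (𝓗 × (Fin 2 → A)) × Θ =>
          (θs, x w.1.1, w.1.2 0, w.1.2 1)) (by fun_prop))).pow_const 2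
    exact (h1.stronglyMeasurable.integral_kernel_prod_right' (κ := (Q j).comap
      (fun z : 𝓗 × (Fin 2 → A) => z.1) (by fun_prop))).measurable
  have hVb : ∀ z, |V z| ≤ 16 * B ^ 2 := fun z =>
    abs_integral_le_of_abs_le fun ϑ => hR.sq_rewardDiff_sub_le _ _ _ _ _
  have hWm : Measurable W := by
    have h1 : Measurable fun w : (𝓗 × (Fin 2 → A)) × Θ =>
        feelGoodGap r act θs w.2 (x w.1.1) (s w.1.1) (w.1.2 (1 - j)) :=
      (hR.measurable_feelGoodGap θs).comp (f := fun w : (𝓗 × (Fin 2 → A)) × Θ =>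
        (w.2, x w.1.1, s w.1.1, w.1.2 (1 - j))) (by fun_prop)
    exact (h1.stronglyMeasurable.integral_kernel_prod_right' (κ := (Q j).comap
      (fun z : 𝓗 × (Fin 2 → A) => z.1) (by fun_prop))).measurable
  have hWb : ∀ z, |W z| ≤ 4 * B := fun z =>
    abs_integral_le_of_abs_le fun ϑ =>
      (hR.abs_feelGoodGap_le (hR.abs_sub_le _ _) _ _ _).trans_eq (by ring)
  set c := Real.exp (-(2 * B)) / 64 with hc
  have hc0 : 0 < c := by positivity
  -- `HasCondLaw.integral_le` asks for one constant bounding both integrands; the right side is the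
  -- sum of their separate bounds.
  have hG : ∀ z (d : ℝ), |d| ≤ (1 / 4 + μ) * (4 * B) → |μ * R z + d| ≤
      μ * (2 * B) + (1 / 4 + μ) * (4 * B) + (c * (16 * B ^ 2) + μ * (4 * B)
        + 16 * μ ^ 2 * B ^ 2) := by
    intro z d hd
    have h0 : 0 ≤ B := by linarith [(abs_nonneg (R z)).trans (hRb z)]
    refine (abs_add_le _ _).trans ?_
    rw [abs_mul, abs_of_pos hμ]
    have h1 := mul_le_mul_of_nonneg_left (hRb z) hμ.le
    have h2 : 0 ≤ c * (16 * B ^ 2) + μ * (4 * B) + 16 * μ ^ 2 * B ^ 2 := by positivity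
    linarith
  set G : 𝓗 × (Fin 2 → A) → ℝ := fun z =>
    μ * R z + (-c * V z + μ * W z + 16 * μ ^ 2 * B ^ 2) with hGdef
  have hGm : Measurable G := by fun_prop
  have hGb : ∀ z, |G z| ≤ μ * (2 * B) + (1 / 4 + μ) * (4 * B) + (c * (16 * B ^ 2) + μ * (4 * B)
        + 16 * μ ^ 2 * B ^ 2) := by
    intro z
    have h0 : 0 ≤ B := by linarith [(abs_nonneg (R z)).trans (hRb z)]
    have h1 := mul_le_mul_of_nonneg_left (hRb z) hμ.le
    have h2 := mul_le_mul_of_nonneg_left (hVb z) hc0.le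
    have h3 := mul_le_mul_of_nonneg_left (hWb z) hμ.le
    rw [← abs_of_pos hμ, ← abs_mul, abs_of_pos hμ] at h1 h3
    rw [← abs_of_pos hc0, ← abs_mul, abs_of_pos hc0] at h2
    have h4 : 0 ≤ (1 / 4 + μ) * (4 * B) := by positivity
    have h5 : 0 ≤ 16 * μ ^ 2 * B ^ 2 := by positivity
    rw [abs_le] at h1 h2 h3 ⊢
    simp only [hGdef]
    constructor <;> linarith [h1.1, h1.2, h2.1, h2.2, h3.1, h3.2]
  have hRi : Integrable (fun ω => R (H ω, fun i => a i ω)) Pr :=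
    Integrable.of_bound (hRm.comp_aemeasurable hy.aemeasurable.fst).aestronglyMeasurable (2 * B)
      (Filter.Eventually.of_forall fun ω => hRb _)
  have hDi : Integrable (fun ω => D ((H ω, fun i => a i ω), y ω)) Pr :=
    Integrable.of_bound (hDm.comp_aemeasurable hy.aemeasurable).aestronglyMeasurable _
      (Filter.Eventually.of_forall fun ω => hDb _)
  refine ⟨hRi, hDi, ?_⟩
  have step1 : ∫ ω, (μ * R (H ω, fun i => a i ω) + D ((H ω, fun i => a i ω), y ω)) ∂Pr
      ≤ ∫ ω, G (H ω, fun i => a i ω) ∂Pr := by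
    refine hy.integral_le (fun z => isProbabilityMeasure_btl r θs _ _)
      (f := fun z => μ * R z.1 + D z) (g := G) (by fun_prop) hGm
      (fun z => hG z.1 (D z) (hDb z)) hGb fun z => ?_
    have := isProbabilityMeasure_btl r θs (x z.1) z.2
    have hDz : Integrable (fun w => D (z, w)) (btl r θs (x z.1) z.2) :=
      integrable_of_abs_le (hDm.comp measurable_prodMk_left) fun w => hDb (z, w)
    change ∫ w, (μ * R z + D (z, w)) ∂btl r θs (x z.1) z.2 ≤ G z
    rw [integral_add (integrable_const _) hDz]
    simp only [integral_const, probReal_univ, one_smul, hGdef]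
    gcongr
    exact hR.integral_btl_log_le hμ.le θs j (x z.1) (s z.1) z.2 (Q j z.1)
  -- Chosen so that `μ / (4 lam) = c`: the decoupled squared error then cancels against the drop of
  -- the log-partition function.
  set lam := 16 * Real.exp (2 * B) * μ with hlam
  have hlam0 : 0 < lam := by positivity
  have harms : Measurable fun z : 𝓗 × Θ × Θ =>
      (z.1, (![rule 0 (z.1, z.2.1), rule 1 (z.1, z.2.2)] : Fin 2 → A)) := by
    refine measurable_fst.prodMk (measurable_pi_iff.2 ?_)
    rw [Fin.forall_fin_two]
    have h0 := hrule 0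
    have h1 := hrule 1
    simp only [Matrix.cons_val_zero, Matrix.cons_val_one]
    constructor <;> fun_prop
  have step2 : ∫ ω, G (H ω, fun i => a i ω) ∂Pr
      ≤ ∫ _, (μ * (lam * dc) + 16 * μ ^ 2 * B ^ 2) ∂Pr := by
    have hae : ∫ ω, G (H ω, fun i => a i ω) ∂Pr
        = ∫ ω, G (H ω, ![rule 0 (H ω, θ 0 ω), rule 1 (H ω, θ 1 ω)]) ∂Pr := by
      refine integral_congr_ae ?_
      filter_upwards [ha 0, ha 1] with ω h0 h1
      have : (fun i => a i ω) = ![rule 0 (H ω, θ 0 ω), rule 1 (H ω, θ 1 ω)] := by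
        ext i
        fin_cases i
        · exact h0
        · exact h1
      rw [this]
    rw [hae]
    refine hθ.integral_le (fun h => inferInstance)
      (f := fun z => G (z.1, ![rule 0 (z.1, z.2.1), rule 1 (z.1, z.2.2)]))
      (g := fun _ => μ * (lam * dc) + 16 * μ ^ 2 * B ^ 2) (hGm.comp harms) measurable_const
      (fun z => (hGb _).trans (le_max_left _ |μ * (lam * dc) + 16 * μ ^ 2 * B ^ 2|))
      (fun z => le_max_right _ _) fun h => ?_
    have hh : Measurable fun w : Θ × Θ =>
        (h, (![rule 0 (h, w.1), rule 1 (h, w.2)] : Fin 2 → A)) :=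
      harms.comp measurable_prodMk_left
    have hR' : Integrable (fun w : Θ × Θ => R (h, ![rule 0 (h, w.1), rule 1 (h, w.2)]))
        ((Q 0 h).prod (Q 1 h)) := integrable_of_abs_le (hRm.comp hh) fun w => hRb _
    have hV' : Integrable (fun w : Θ × Θ => V (h, ![rule 0 (h, w.1), rule 1 (h, w.2)]))
        ((Q 0 h).prod (Q 1 h)) := integrable_of_abs_le (hVm.comp hh) fun w => hVb _
    have hW' : Integrable (fun w : Θ × Θ => W (h, ![rule 0 (h, w.1), rule 1 (h, w.2)]))
        ((Q 0 h).prod (Q 1 h)) := integrable_of_abs_le (hWm.comp hh) fun w => hWb _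
    have key := hR.integral_pair_regret_le hdc hlam0 (x h) (s h) (fun j => Q j h)
      (sel := fun j θ => rule j (h, θ)) (fun j => (hrule j).comp measurable_prodMk_left)
      (fun j θ => hmax j h θ) j
    have hcμ : μ * (1 / (4 * lam)) = c := by
      rw [hlam, hc, Real.exp_neg]
      field_simp
      norm_num
    calc ∫ w, G (h, ![rule 0 (h, w.1), rule 1 (h, w.2)]) ∂(Q 0 h).prod (Q 1 h)
        = μ * ∫ w, R (h, ![rule 0 (h, w.1), rule 1 (h, w.2)]) ∂(Q 0 h).prod (Q 1 h)
          + (-c * ∫ w, V (h, ![rule 0 (h, w.1), rule 1 (h, w.2)]) ∂(Q 0 h).prod (Q 1 h)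
          + μ * ∫ w, W (h, ![rule 0 (h, w.1), rule 1 (h, w.2)]) ∂(Q 0 h).prod (Q 1 h)
          + 16 * μ ^ 2 * B ^ 2) := by
          simp only [hGdef]
          have hVW : Integrable (fun w : Θ × Θ => -c * V (h, ![rule 0 (h, w.1), rule 1 (h, w.2)])
              + μ * W (h, ![rule 0 (h, w.1), rule 1 (h, w.2)])) ((Q 0 h).prod (Q 1 h)) :=
            (hV'.const_mul (-c)).add (hW'.const_mul μ)
          have hVW' : Integrable (fun w : Θ × Θ => -c * V (h, ![rule 0 (h, w.1), rule 1 (h, w.2)])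
              + μ * W (h, ![rule 0 (h, w.1), rule 1 (h, w.2)]) + 16 * μ ^ 2 * B ^ 2)
              ((Q 0 h).prod (Q 1 h)) := hVW.add (integrable_const _)
          rw [integral_add (hR'.const_mul μ) hVW', integral_add hVW (integrable_const _),
            integral_add (hV'.const_mul (-c)) (hW'.const_mul μ), integral_const_mul,
            integral_const_mul, integral_const_mul]
          simp
      _ ≤ _ := by
          have h1 := mul_le_mul_of_nonneg_left key hμ.le
          rw [mul_sub, mul_add, ← mul_assoc μ (1 / (4 * lam)), hcμ] at h1
          change μ * ∫ w, R (h, ![rule 0 (h, w.1), rule 1 (h, w.2)]) ∂(Q 0 h).prod (Q 1 h)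
            ≤ μ * (lam * dc)
              + c * ∫ w, V (h, ![rule 0 (h, w.1), rule 1 (h, w.2)]) ∂(Q 0 h).prod (Q 1 h)
              - μ * ∫ w, W (h, ![rule 0 (h, w.1), rule 1 (h, w.2)]) ∂(Q 0 h).prod (Q 1 h) at h1
          linarith
  rw [integral_add (hRi.const_mul μ) hDi, integral_const_mul] at step1
  refine (step1.trans step2).trans_eq ?_
  simp

end Round

/-! ### Exponential tilting -/

section Tilting

variable {E : Type*} [MeasurableSpace E]

lemma tilted_add_const (π : Measure E) (f : E → ℝ) (c : ℝ) :
    π.tilted (fun e => f e + c) = π.tilted f := by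
  simp only [Measure.tilted, Real.exp_add, integral_mul_const]
  congr 1
  ext e
  rw [mul_div_mul_right _ _ (Real.exp_ne_zero c)]

/-- Each term is the logarithm of a ratio of consecutive partition functions. -/
lemma sum_log_integral_exp_tilted (π : Measure E) [IsProbabilityMeasure π] {g : ℕ → E → ℝ}
    (hg : ∀ i, Measurable (g i)) {K : ℝ} (hK : ∀ i e, |g i e| ≤ K) (T : ℕ) :
    ∑ t ∈ Finset.range T, Real.log (∫ e, Real.exp (g t e) ∂π.tilted fun e => ∑ i : Fin t, g i e)
      = Real.log (∫ e, Real.exp (∑ i ∈ Finset.range T, g i e) ∂π) := by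
  have hpos : ∀ n, 0 < ∫ e, Real.exp (∑ i ∈ Finset.range n, g i e) ∂π := fun n =>
    (Real.exp_pos _).trans_le (exp_neg_le_integral_exp (K := n * K)
      (Finset.measurable_sum _ fun i _ => hg i) fun e =>
        (Finset.abs_sum_le_sum_abs _ _).trans ((Finset.sum_le_sum fun i _ => hK i e).trans_eq
          (by simp)))
  induction T with
  | zero => simp
  | succ n ih =>
    rw [Finset.sum_range_succ, ih, integral_exp_tilted]
    have hfin : ∀ e, ∑ i : Fin n, g i e = ∑ i ∈ Finset.range n, g i e := fun e =>
      Fin.sum_univ_eq_sum_range (fun i => g i e) n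
    simp only [Pi.add_apply, hfin, ← Finset.sum_range_succ]
    rw [Real.log_div (hpos _).ne' (hpos _).ne']
    ring

lemma log_integral_exp_ge (π : Measure E) [IsProbabilityMeasure π] {f : E → ℝ}
    (hf : Measurable f) {K : ℝ} (hK : ∀ e, |f e| ≤ K) {s : Set E} (hs : MeasurableSet s)
    (hs0 : 0 < π.real s) {c : ℝ} (hc : ∀ e ∈ s, -c ≤ f e) :
    Real.log (π.real s) - c ≤ Real.log (∫ e, Real.exp (f e) ∂π) := by
  have hi : Integrable (fun e => Real.exp (f e)) π :=
    integrable_of_abs_le hf.exp (K := Real.exp K) fun e => by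
      rw [Real.abs_exp]
      exact Real.exp_le_exp.2 (abs_le.1 (hK e)).2
  have h : π.real s * Real.exp (-c) ≤ ∫ e, Real.exp (f e) ∂π := by
    calc π.real s * Real.exp (-c) = ∫ _ in s, Real.exp (-c) ∂π := by simp
      _ ≤ ∫ e in s, Real.exp (f e) ∂π :=
        setIntegral_mono_on (integrable_const _) hi.integrableOn hs fun e he =>
          Real.exp_le_exp.2 (hc e he)
      _ ≤ _ := setIntegral_le_integral hi (Filter.Eventually.of_forall fun e =>
          (Real.exp_pos _).le)
  have h2 := Real.log_le_log (by positivity) h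
  rwa [Real.log_mul hs0.ne' (Real.exp_ne_zero _), Real.log_exp, ← sub_eq_add_neg] at h2

end Tilting

/-! ### The prior -/

lemma prior_real_ge {Θ : Type*} [PseudoMetricSpace Θ] [MeasurableSpace Θ] [OpensMeasurableSpace Θ]
    {μbar : Measure Θ} {p₀ : Θ → ℝ} (hp₀ : ∀ θ, 0 < p₀ θ) [IsProbabilityMeasure (prior μbar p₀)]
    {L : NNReal} (hL : LipschitzWith L fun θ => Real.log (p₀ θ)) (θs : Θ) (ρ : ℝ) :
    Real.exp (-(L * ρ)) * (p₀ θs * μbar.real {θ | dist θ θs ≤ ρ})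
      ≤ (prior μbar p₀).real {θ | dist θ θs ≤ ρ} := by
  have hms : MeasurableSet {θ | dist θ θs ≤ ρ} := Metric.isClosed_closedBall.measurableSet
  have hpt : ∀ θ ∈ {θ | dist θ θs ≤ ρ}, Real.exp (-(L * ρ)) * p₀ θs ≤ p₀ θ := by
    intro θ hθ
    have h1 := hL.dist_le_mul θ θs
    rw [Real.dist_eq] at h1
    have h2 : (L : ℝ) * dist θ θs ≤ L * ρ := mul_le_mul_of_nonneg_left hθ L.2
    rw [← Real.exp_log (hp₀ θs), ← Real.exp_log (hp₀ θ), ← Real.exp_add]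
    apply Real.exp_le_exp.2
    linarith [(abs_le.1 h1).1]
  have h : ENNReal.ofReal (Real.exp (-(L * ρ)) * p₀ θs) * μbar {θ | dist θ θs ≤ ρ}
      ≤ prior μbar p₀ {θ | dist θ θs ≤ ρ} := by
    rw [prior, withDensity_apply _ hms, ← setLIntegral_const]
    exact setLIntegral_mono' hms fun θ hθ => ENNReal.ofReal_le_ofReal (hpt θ hθ)
  have h2 := ENNReal.toReal_mono (measure_ne_top _ _) h
  rw [ENNReal.toReal_mul, ENNReal.toReal_ofReal
    (mul_nonneg (Real.exp_pos _).le (hp₀ θs).le)] at h2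
  rw [← mul_assoc]
  exact h2

/-! ### The posterior -/

section Posterior

variable {Θ X S A : Type*} [MeasurableSpace Θ] {r : Θ → X → A → ℝ} {act : S → Set A}

/-- Normalization removes the loss at `θs`, which does not depend on the sampled parameter; the
excess losses are uniformly bounded. -/
lemma fgPosterior_eq_tilted (μbar : Measure Θ) (p₀ : Θ → ℝ) (η μ : ℝ) (θs : Θ) (j : Fin 2)
    {t : ℕ} (h : Past X S A t) :
    fgPosterior r act μbar p₀ η μ j h
      = (prior μbar p₀).tilted fun θ => ∑ i, -lossGap r act η μ θs j θ (h i) := by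
  rw [fgPosterior, ← tilted_add_const _ _ (∑ i, feelGoodLoss r act η μ j θs (h i))]
  congr 1
  ext θ
  simp only [lossGap, neg_sub, Finset.sum_sub_distrib]
  ring

lemma IsRewardClass.isProbabilityMeasure_fgPosterior [MeasurableSpace X] [MeasurableSpace S]
    [MeasurableSpace A] {B : ℝ} (hR : IsRewardClass r act B) (θs : Θ) {μbar : Measure Θ}
    {p₀ : Θ → ℝ} [IsProbabilityMeasure (prior μbar p₀)] {η μ : ℝ} (hη : 0 ≤ η) (hμ : 0 ≤ μ)
    (j : Fin 2) {t : ℕ} (h : Past X S A t) :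
    IsProbabilityMeasure (fgPosterior r act μbar p₀ η μ j h) := by
  rw [fgPosterior_eq_tilted μbar p₀ η μ θs]
  have hb : ∀ θ i, |-lossGap r act η μ θs j θ (h i)| ≤ (η + μ) * (2 * (2 * B)) := fun θ i => by
    rw [abs_neg]
    exact hR.abs_lossGap_le hη hμ (hR.abs_sub_le θ θs) j (h i)
  have hm : Measurable fun θ => ∑ i, -lossGap r act η μ θs j θ (h i) :=
    Finset.measurable_sum _ fun i _ => ((hR.measurable_lossGap η μ θs j).comp
      (f := fun θ : Θ => (θ, h i)) (by fun_prop)).neg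
  refine isProbabilityMeasure_tilted (integrable_of_abs_le hm.exp
    (K := Real.exp (t * ((η + μ) * (2 * (2 * B))))) fun θ => ?_)
  rw [Real.abs_exp]
  refine Real.exp_le_exp.2 ((le_abs_self _).trans ((Finset.abs_sum_le_sum_abs _ _).trans
    ((Finset.sum_le_sum fun i _ => hb θ i).trans_eq (by simp))))

end Posterior

/-! ### The decoupling coefficient -/

/-- For a point mass the two sides see the same deviation `z`. At `lam = z / 2` the inequality reads
`z ≤ (z / 2) dc + z / 2`. -/
lemma IsDecouplingCoeff.one_le {Θ X A : Type*} [MeasurableSpace Θ] [MeasurableSpace X]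
    [MeasurableSpace A] {r : Θ → X → A → ℝ}
    (hr : Measurable fun z : Θ × X × A => r z.1 z.2.1 z.2.2) {θs : Θ} {dc : ℝ}
    (hdc : IsDecouplingCoeff r θs dc) {θ : Θ} {x : X} {a b : A}
    (h : rewardDiff r θ x a b ≠ rewardDiff r θs x a b) : 1 ≤ dc := by
  wlog hlt : rewardDiff r θs x a b < rewardDiff r θ x a b generalizing a b
  · refine this (a := b) (b := a) ?_ ?_
    · simp only [rewardDiff] at h ⊢
      contrapose! h
      linarith
    · have := lt_of_le_of_ne (not_lt.1 hlt) h
      simp only [rewardDiff] at this ⊢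
      linarith
  set z := rewardDiff r θ x a b - rewardDiff r θs x a b with hz
  have hz0 : 0 < z := sub_pos.2 hlt
  have hm : Measurable fun w : Θ × A × A =>
      rewardDiff r w.1 x w.2.1 w.2.2 - rewardDiff r θs x w.2.1 w.2.2 := by
    unfold rewardDiff
    have h1 : ∀ f : Θ × A × A → Θ × X × A, Measurable f →
        Measurable fun w => r (f w).1 (f w).2.1 (f w).2.2 := fun f hf => hr.comp hf
    exact ((h1 (fun w => (w.1, x, w.2.1)) (by fun_prop)).sub
      (h1 (fun w => (w.1, x, w.2.2)) (by fun_prop))).sub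
      ((h1 (fun w => (θs, x, w.2.1)) (by fun_prop)).sub
        (h1 (fun w => (θs, x, w.2.2)) (by fun_prop)))
  have hD := hdc (z / 2) (by positivity) x (Measure.dirac (θ, a, b)) inferInstance
  have hm3 : Measurable fun ϑ : Θ => (rewardDiff r ϑ x a b - rewardDiff r θs x a b) ^ 2 :=
    (hm.comp (f := fun ϑ : Θ => (ϑ, a, b)) (by fun_prop)).pow_const 2
  have hm4 : ∀ ϑ : Θ, Measurable fun p : A × A =>
      (rewardDiff r ϑ x p.1 p.2 - rewardDiff r θs x p.1 p.2) ^ 2 := fun ϑ =>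
    (hm.comp (f := fun p : A × A => (ϑ, p)) (by fun_prop)).pow_const 2
  have hfst : (Measure.dirac (θ, a, b)).fst = Measure.dirac θ := Measure.map_dirac' measurable_fst _
  have hsnd : (Measure.dirac (θ, a, b)).snd = Measure.dirac (a, b) :=
    Measure.map_dirac' measurable_snd _
  rw [integral_dirac' _ _ hm.stronglyMeasurable, hfst, hsnd] at hD
  simp only [fun ϑ => integral_dirac' _ (a, b) (hm4 ϑ).stronglyMeasurable] at hD
  rw [integral_dirac' _ _ hm3.stronglyMeasurable, ← hz] at hD
  have e : 1 / (4 * (z / 2)) * z ^ 2 = z / 2 := by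
    field_simp
    norm_num
  rw [e] at hD
  nlinarith

/-! ### Regret of a run -/

lemma eq_iSup_of_isMaxOn {A : Type*} {f : A → ℝ} {s : Set A} {a : A} (ha : a ∈ s) (hmax : IsMaxOn f s a) :
    f a = ⨆ b : s, f b := by
  have : Nonempty s := ⟨⟨a, ha⟩⟩
  refine le_antisymm (le_ciSup (f := fun b : s => f b) ⟨f a, ?_⟩ ⟨a, ha⟩)
    (ciSup_le fun b => hmax b.2)
  rintro _ ⟨b, rfl⟩
  exact hmax b.2

lemma integral_regret_eq {Θ X S A Ω : Type*} [MeasurableSpace Ω] {Pr : Measure Ω}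
    {r : Θ → X → A → ℝ} {act : S → Set A} {θs : Θ} {T : ℕ} {p : Interaction Ω Θ X S A} (hi : ∀ j : Fin 2, ∀ t < T,
      Integrable (fun ω => (⨆ b : act (p.s t ω), r θs (p.x t ω) b)
        - r θs (p.x t ω) (p.a t j ω)) Pr) :
    Integrable (p.regret r act θs T) Pr ∧
    ∫ ω, p.regret r act θs T ω ∂Pr
      = (∑ t ∈ Finset.range T, ∫ ω, ((⨆ b : act (p.s t ω), r θs (p.x t ω) b)
          - r θs (p.x t ω) (p.a t 0 ω)) ∂Pr
        + ∑ t ∈ Finset.range T, ∫ ω, ((⨆ b : act (p.s t ω), r θs (p.x t ω) b)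
          - r θs (p.x t ω) (p.a t 1 ω)) ∂Pr) / 2 := by
  have e : p.regret r act θs T = fun ω => ∑ t ∈ Finset.range T,
      (((⨆ b : act (p.s t ω), r θs (p.x t ω) b) - r θs (p.x t ω) (p.a t 0 ω))
        + ((⨆ b : act (p.s t ω), r θs (p.x t ω) b) - r θs (p.x t ω) (p.a t 1 ω))) / 2 := by
    ext ω
    refine Finset.sum_congr rfl fun t _ => ?_
    ring
  have hint : ∀ t ∈ Finset.range T, Integrable (fun ω =>
      (((⨆ b : act (p.s t ω), r θs (p.x t ω) b) - r θs (p.x t ω) (p.a t 0 ω))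
        + ((⨆ b : act (p.s t ω), r θs (p.x t ω) b) - r θs (p.x t ω) (p.a t 1 ω))) / 2) Pr :=
    fun t ht => ((hi 0 t (Finset.mem_range.1 ht)).add (hi 1 t (Finset.mem_range.1 ht))).div_const 2
  rw [e]
  refine ⟨integrable_finsetSum _ hint, ?_⟩
  rw [integral_finsetSum _ hint, ← Finset.sum_add_distrib, Finset.sum_div]
  refine Finset.sum_congr rfl fun t ht => ?_
  rw [integral_div, integral_add (hi 0 t (Finset.mem_range.1 ht)) (hi 1 t (Finset.mem_range.1 ht))]

section Run

variable {Θ X S A Ω : Type*} [MeasurableSpace Θ] [MeasurableSpace X] [MeasurableSpace S]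
  [MeasurableSpace A] [MeasurableSpace Ω] {p : Interaction Ω Θ X S A} {Pr : Measure Ω}
  {r : Θ → X → A → ℝ} {act : S → Set A} {μbar : Measure Θ} {p₀ : Θ → ℝ} {θs : Θ} {η μ : ℝ} {T : ℕ}

/-- Measurability of the supremum is extracted from the measurable tie-breaking rule: the maximal
reward is the reward of the selected arm. -/
lemma IsFGTSRun.isRewardClass (h : IsFGTSRun p Pr r act μbar p₀ θs η μ T)
    [IsProbabilityMeasure Pr] (hT : 1 ≤ T)
    (hr : Measurable fun z : Θ × X × A => r z.1 z.2.1 z.2.2) {B : ℝ}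
    (hB : ∀ θ x a, |r θ x a| ≤ B) : IsRewardClass r act B := by
  obtain ⟨rule, hrule, hmax, -⟩ := h.arm 0 hT 0
  have := Pr.nonempty_of_neZero
  obtain ⟨ω⟩ := this
  -- Before round `0` the past is empty, so the prompt and the action space can be varied freely in
  -- the history.
  refine ⟨hr, hB, ?_, fun s => ⟨_, (hmax (Fin.elim0, p.x 0 ω, s) θs).1⟩⟩
  have e : ∀ z : Θ × X × S, ⨆ b : act z.2.2, r z.1 z.2.1 b
      = r z.1 z.2.1 (rule ((Fin.elim0, z.2.1, z.2.2), z.1)) := fun z =>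
    (eq_iSup_of_isMaxOn (hmax (Fin.elim0, z.2.1, z.2.2) z.1).1 (hmax _ z.1).2).symm
  simp only [e]
  exact hr.comp (f := fun z : Θ × X × S =>
    (z.1, z.2.1, rule ((Fin.elim0, z.2.1, z.2.2), z.1))) (by fun_prop)

/-- The cumulative regret of the `j`-th arm, up to the mass that the prior puts on a set of
parameters whose rewards are uniformly close to the true ones. -/
lemma IsFGTSRun.arm_regret_bound (h : IsFGTSRun p Pr r act μbar p₀ θs (1 / 4) μ T)
    [IsProbabilityMeasure Pr] [IsProbabilityMeasure (prior μbar p₀)] {B : ℝ}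
    (hR : IsRewardClass r act B) {dc : ℝ} (hdc : IsDecouplingCoeff r θs dc) (hμ : 0 < μ)
    {s : Set Θ} (hs : MeasurableSet s) (hs0 : 0 < (prior μbar p₀).real s) {ε : ℝ}
    (hε : ∀ θ ∈ s, ∀ x a, |r θ x a - r θs x a| ≤ ε) (j : Fin 2) :
    (∀ t < T, Integrable (fun ω => (⨆ b : act (p.s t ω), r θs (p.x t ω) b)
      - r θs (p.x t ω) (p.a t j ω)) Pr) ∧
    μ * ∑ t ∈ Finset.range T, ∫ ω, ((⨆ b : act (p.s t ω), r θs (p.x t ω) b)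
        - r θs (p.x t ω) (p.a t j ω)) ∂Pr
      ≤ T * (μ * (16 * Real.exp (2 * B) * μ * dc) + 16 * μ ^ 2 * B ^ 2)
        - (Real.log ((prior μbar p₀).real s) - T * ((1 / 4 + μ) * (2 * ε))) := by
  set D : ℕ → Ω → ℝ := fun t ω => Real.log (∫ ϑ, Real.exp
    (-lossGap r act (1 / 4) μ θs j ϑ (p.obs t ω))
      ∂fgPosterior r act μbar p₀ (1 / 4) μ j (p.hist t ω).1) with hD
  have round : ∀ t < T, Integrable (fun ω => (⨆ b : act (p.s t ω), r θs (p.x t ω) b)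
        - r θs (p.x t ω) (p.a t j ω)) Pr ∧ Integrable (D t) Pr ∧
      μ * ∫ ω, ((⨆ b : act (p.s t ω), r θs (p.x t ω) b) - r θs (p.x t ω) (p.a t j ω)) ∂Pr
        + ∫ ω, D t ω ∂Pr ≤ μ * (16 * Real.exp (2 * B) * μ * dc) + 16 * μ ^ 2 * B ^ 2 := by
    intro t ht
    have hpost : ∀ (i : Fin 2) (z : Hist X S A t),
        IsProbabilityMeasure (fgPosterior r act μbar p₀ (1 / 4) μ i z.1) := fun i z =>
      hR.isProbabilityMeasure_fgPosterior θs (by norm_num) hμ.le i z.1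
    obtain ⟨K, hK, hcond⟩ := h.sample t ht
    choose rule hrule hmax ha using h.arm t ht
    -- Only the joint sampling law is given as a kernel; its marginals supply the measurability of
    -- each posterior in the history.
    set Q : Fin 2 → Kernel (Hist X S A t) Θ := ![K.fst, K.snd] with hQ
    have hQeq : ∀ i z, Q i z = fgPosterior r act μbar p₀ (1 / 4) μ i z.1 := by
      intro i z
      have h0 := hpost 0 z
      have h1 := hpost 1 z
      fin_cases i
      · change K.fst z = _
        rw [Kernel.fst_apply, hK]
        exact (measurePreserving_fst (μ := fgPosterior r act μbar p₀ (1 / 4) μ 0 z.1)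
          (ν := fgPosterior r act μbar p₀ (1 / 4) μ 1 z.1)).map_eq
      · change K.snd z = _
        rw [Kernel.snd_apply, hK]
        exact (measurePreserving_snd (μ := fgPosterior r act μbar p₀ (1 / 4) μ 0 z.1)
          (ν := fgPosterior r act μbar p₀ (1 / 4) μ 1 z.1)).map_eq
    have hQm : ∀ i, IsMarkovKernel (Q i) := fun i => ⟨fun z => by rw [hQeq]; exact hpost i z⟩
    have := hR.round_bound hdc hμ (H := p.hist t) (x := fun z : Hist X S A t => z.2.1)
      (s := fun z : Hist X S A t => z.2.2) (by fun_prop) (by fun_prop) Q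
      (θ := p.θ t) (a := p.a t) (y := p.y t)
      ⟨K, fun z => by simp only [hQeq]; exact hK z, hcond⟩ hrule
      (fun i z θ => eq_iSup_of_isMaxOn (hmax i z θ).1 (hmax i z θ).2) ha (h.preference t ht) j
    simp only [hQeq] at this
    exact this
  refine ⟨fun t ht => (round t ht).1, ?_⟩
  have hDsum : ∀ ω, Real.log ((prior μbar p₀).real s) - T * ((1 / 4 + μ) * (2 * ε))
      ≤ ∑ t ∈ Finset.range T, D t ω := by
    intro ω
    have hgm : ∀ i, Measurable fun θ => -lossGap r act (1 / 4) μ θs j θ (p.obs i ω) := fun i =>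
      ((hR.measurable_lossGap (1 / 4) μ θs j).comp (f := fun θ : Θ => (θ, p.obs i ω))
        (by fun_prop)).neg
    have hgb : ∀ i θ, |-lossGap r act (1 / 4) μ θs j θ (p.obs i ω)|
        ≤ (1 / 4 + μ) * (2 * (2 * B)) := fun i θ => by
      rw [abs_neg]
      exact hR.abs_lossGap_le (by norm_num) hμ.le (hR.abs_sub_le θ θs) j _
    have hsum := sum_log_integral_exp_tilted (prior μbar p₀) hgm hgb T
    have hDeq : ∑ t ∈ Finset.range T, D t ω = Real.log (∫ θ, Real.exp
        (∑ i ∈ Finset.range T, -lossGap r act (1 / 4) μ θs j θ (p.obs i ω)) ∂prior μbar p₀) := by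
      rw [← hsum]
      refine Finset.sum_congr rfl fun t _ => ?_
      rw [hD]
      simp only [fgPosterior_eq_tilted μbar p₀ (1 / 4) μ θs]
      rfl
    rw [hDeq]
    refine log_integral_exp_ge (prior μbar p₀) (Finset.measurable_sum _ fun i _ => hgm i)
      (K := T * ((1 / 4 + μ) * (2 * (2 * B)))) (fun θ => ?_) hs hs0 fun θ hθ => ?_
    · exact (Finset.abs_sum_le_sum_abs _ _).trans
        ((Finset.sum_le_sum fun i _ => hgb i θ).trans_eq (by simp))
    · have hl : ∀ i ∈ Finset.range T, -((1 / 4 + μ) * (2 * ε))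
          ≤ -lossGap r act (1 / 4) μ θs j θ (p.obs i ω) := fun i _ =>
        neg_le_neg ((le_abs_self _).trans
          (hR.abs_lossGap_le (by norm_num) hμ.le (hε θ hθ) j _))
      refine le_trans (le_of_eq ?_) (Finset.sum_le_sum hl)
      simp
  have hDi : ∑ t ∈ Finset.range T, ∫ ω, D t ω ∂Pr
      ≥ Real.log ((prior μbar p₀).real s) - T * ((1 / 4 + μ) * (2 * ε)) := by
    have hint : ∀ t ∈ Finset.range T, Integrable (D t) Pr := fun t ht =>
      (round t (Finset.mem_range.1 ht)).2.1
    rw [← integral_finsetSum _ hint]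
    calc _ = ∫ _, (Real.log ((prior μbar p₀).real s) - T * ((1 / 4 + μ) * (2 * ε))) ∂Pr := by
          rw [integral_const, probReal_univ, one_smul]
      _ ≤ _ := integral_mono (integrable_const _) (integrable_finsetSum _ hint) hDsum
  have htot := Finset.sum_le_sum fun t (ht : t ∈ Finset.range T) =>
    (round t (Finset.mem_range.1 ht)).2.2
  rw [Finset.sum_add_distrib, ← Finset.mul_sum, Finset.sum_const, Finset.card_range,
    nsmul_eq_mul] at htot
  linarith

/-- If all rewards of the class order the arms as the true one does, with equal differences, there
is no regret. -/
lemma IsFGTSRun.integral_regret_nonpos (h : IsFGTSRun p Pr r act μbar p₀ θs η μ T)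
    (heq : ∀ θ x a b, rewardDiff r θ x a b = rewardDiff r θs x a b) (j : Fin 2) :
    ∑ t ∈ Finset.range T, ∫ ω, ((⨆ b : act (p.s t ω), r θs (p.x t ω) b)
      - r θs (p.x t ω) (p.a t j ω)) ∂Pr ≤ 0 := by
  refine Finset.sum_nonpos fun t ht => integral_nonpos_of_ae ?_
  obtain ⟨rule, -, hmax, ha⟩ := h.arm t (Finset.mem_range.1 ht) j
  filter_upwards [ha] with ω hω
  have hm := hmax (p.hist t ω) (p.θ t j ω)
  rw [← hω] at hm
  have : Nonempty (act (p.s t ω)) := ⟨⟨_, hm.1⟩⟩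
  have : (⨆ b : act (p.s t ω), r θs (p.x t ω) b) ≤ r θs (p.x t ω) (p.a t j ω) := by
    refine ciSup_le fun b => ?_
    have h1 : r (p.θ t j ω) (p.x t ω) b ≤ r (p.θ t j ω) (p.x t ω) (p.a t j ω) := hm.2 b.2
    have h2 := heq (p.θ t j ω) (p.x t ω) b (p.a t j ω)
    simp only [rewardDiff] at h2
    linarith
  simpa using this

end Run

/-! ### The choice of the parameters -/

/-- The regret bound of a run for the stated choice of `μ`, in terms of the prior mass. -/
lemma tuned_bound {B T dc l q κ S R μ : ℝ} (hB : 0 ≤ B) (hT : 0 < T) (hl : 0 < l) (hdc : 1 ≤ dc)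
    (hR : R = √(T * dc * l)) (hμ : μ = Real.exp (-B) / 5 * √(l / (T * dc)))
    (hq : -(l + κ) ≤ q)
    (h : μ * S ≤ T * (μ * (16 * Real.exp (2 * B) * μ * dc) + 16 * μ ^ 2 * B ^ 2)
      - (q - T * ((1 / 4 + μ) * (2 * (2 / T))))) :
    S ≤ 4 + 5 * Real.exp B * R * (2 + (1 + κ) / l) := by
  have hdc0 : 0 < dc := by linarith
  have hN : 0 < T * dc := by positivity
  set N := T * dc
  set x := Real.exp B with hx
  have hx0 : 0 < x := Real.exp_pos _
  have hx2 : Real.exp (2 * B) = x ^ 2 := by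
    rw [hx, ← Real.exp_nat_mul]
    norm_num
  -- From `1 + z + z² / 2 ≤ exp z` at `z = 2B`.
  have hxB : 2 * B ^ 2 ≤ x ^ 2 := by
    have := Real.quadratic_le_exp_of_nonneg (x := 2 * B) (by linarith)
    rw [hx2] at this
    nlinarith
  have hμ0 : 0 < μ := by rw [hμ]; positivity
  have hR0 : 0 < R := by rw [hR]; positivity
  have hRN : R = √(l / N) * N := by
    rw [hR, ← Real.sqrt_sq hN.le, ← Real.sqrt_mul (by positivity), Real.sqrt_sq hN.le]
    congr 1
    field_simp
  have h1 : 5 * x * (μ * N) = R := by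
    rw [hRN, hμ, Real.exp_neg, ← hx]
    field_simp
  have hR2 : R ^ 2 = N * l := by rw [hR, Real.sq_sqrt (by positivity)]
  -- Equivalently `1 / μ = 5 exp B * R / l`, the factor in the claimed bound.
  have h2 : 5 * x * (μ * R) = l := by
    have : (5 * x * (μ * R)) * N = l * N := by
      calc _ = (5 * x * (μ * N)) * R := by ring
        _ = l * N := by rw [h1, ← sq, hR2]; ring
    exact mul_right_cancel₀ hN.ne' this
  rw [hx2] at h
  -- compare after multiplication by `μ`
  refine le_of_mul_le_mul_left ?_ hμ0
  have hTdc : T ≤ N := le_mul_of_one_le_right hT.le hdc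
  have e1 : T * ((1 / 4 + μ) * (2 * (2 / T))) = 1 + 4 * μ := by
    field_simp
    ring
  have e2 : μ * (4 + 5 * x * R * (2 + (1 + κ) / l)) = 4 * μ + 2 * l + (1 + κ) := by
    have : μ * (4 + 5 * x * R * (2 + (1 + κ) / l))
        = 4 * μ + (5 * x * (μ * R)) * (2 + (1 + κ) / l) := by ring
    rw [this, h2]
    field_simp
    ring
  -- This term and the next total `24/25 * l ≤ l`; the other `l` of the target comes from `-q`.
  have e3 : T * (μ * (16 * x ^ 2 * μ * dc)) = 16 / 25 * l := by
    calc _ = 16 / 25 * (5 * x * (μ * N)) * (5 * x * μ) := by simp only [N]; ring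
      _ = 16 / 25 * (5 * x * (μ * R)) := by rw [h1]; ring
      _ = _ := by rw [h2]
  have e4 : T * (16 * μ ^ 2 * B ^ 2) ≤ 8 / 25 * l := by
    calc T * (16 * μ ^ 2 * B ^ 2) = 8 * μ ^ 2 * (T * (2 * B ^ 2)) := by ring
      _ ≤ 8 * μ ^ 2 * (N * x ^ 2) := by gcongr
      _ = 8 / 25 * (5 * x * (μ * N)) * (5 * x * μ) := by ring
      _ = 8 / 25 * (5 * x * (μ * R)) := by rw [h1]; ring
      _ = _ := by rw [h2]
  rw [e1] at h
  rw [e2]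
  linarith

/-! ### The regret bound -/

section RegretBound

variable {Θ X S A : Type*} [MetricSpace Θ] [MeasurableSpace Θ] {μbar : Measure Θ}
  {r : Θ → X → A → ℝ} {θs : Θ} {act : S → Set A} {L₀ : NNReal} {p₀ : Θ → ℝ} {B : ℝ}

lemma antitone_log_one_div_measure {ρ ρ' : ℝ} (hp : 0 < p₀ θs) (hρ : ρ ≤ ρ')
    (h : 0 < p₀ θs * μbar.real {θ | dist θ θs ≤ ρ})
    (h' : 0 < p₀ θs * μbar.real {θ | dist θ θs ≤ ρ'}) :
    Real.log (1 / (p₀ θs * μbar.real {θ | dist θ θs ≤ ρ'}))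
      ≤ Real.log (1 / (p₀ θs * μbar.real {θ | dist θ θs ≤ ρ})) := by
  -- `Measure.real` sends infinite mass to `0`, so positivity of the real mass also gives
  -- finiteness.
  have hfin : μbar {θ | dist θ θs ≤ ρ'} ≠ ⊤ := by
    intro htop
    simp [Measure.real, htop] at h'
  have hmono : μbar.real {θ | dist θ θs ≤ ρ} ≤ μbar.real {θ | dist θ θs ≤ ρ'} :=
    ENNReal.toReal_mono hfin (measure_mono fun θ hθ => le_trans hθ hρ)
  apply Real.log_le_log (by positivity)
  gcongr

/-- The logarithmic term is bounded away from zero over the rounds where it is positive. -/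
lemma exists_pos_le_logTerm (μbar : Measure Θ) (hp : 0 < p₀ θs) (hL₀ : 0 < L₀) :
    ∃ l₀ : ℝ, 0 < l₀ ∧ ∀ T : ℕ, 1 ≤ T →
      0 < p₀ θs * μbar.real {θ | dist θ θs ≤ 2 / (L₀ * T)} →
      p₀ θs * μbar.real {θ | dist θ θs ≤ 2 / (L₀ * T)} < 1 → l₀ ≤ logTerm μbar p₀ θs L₀ T := by
  classical
  by_cases hex : ∃ T : ℕ, 1 ≤ T ∧ 0 < p₀ θs * μbar.real {θ | dist θ θs ≤ 2 / (L₀ * T)} ∧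
      p₀ θs * μbar.real {θ | dist θ θs ≤ 2 / (L₀ * T)} < 1
  -- The ball shrinks as `T` grows, so the smallest admissible horizon has the smallest logarithmic
  -- term.
  · obtain ⟨hT, h0, h1⟩ := Nat.find_spec hex
    refine ⟨logTerm μbar p₀ θs L₀ (Nat.find hex), Real.log_pos (one_lt_one_div h0 h1),
      fun T' hT' h0' h1' => antitone_log_one_div_measure hp ?_ h0' h0⟩
    have hle : Nat.find hex ≤ T' := Nat.find_min' hex ⟨hT', h0', h1'⟩
    have hLr : (0 : ℝ) < L₀ := hL₀
    have hTr : (0 : ℝ) < (Nat.find hex : ℝ) := by exact_mod_cast hT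
    have hler : (Nat.find hex : ℝ) ≤ T' := by exact_mod_cast hle
    gcongr
  · exact ⟨1, one_pos, fun T hT h0 h1 => absurd ⟨T, hT, h0, h1⟩ hex⟩

lemma IsFGTSRun.integral_regret_le [OpensMeasurableSpace Θ] [MeasurableSpace X]
    [MeasurableSpace S] [MeasurableSpace A] {Ω : Type*} [MeasurableSpace Ω] {Pr : Measure Ω}
    [IsProbabilityMeasure Pr] {p : Interaction Ω Θ X S A} {dc : ℝ} {T : ℕ}
    (h : IsFGTSRun p Pr r act μbar p₀ θs (η := 0.25)
      (μ := Real.exp (-B) / 5 * √(logTerm μbar p₀ θs L₀ T / (T * dc))) T)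
    (hT : 1 ≤ T) (hr : Measurable fun z : Θ × X × A => r z.1 z.2.1 z.2.2)
    (hB : ∀ θ x a, |r θ x a| ≤ B) (hL₀ : 0 < L₀) (hrL : ∀ x a, LipschitzWith L₀ fun θ => r θ x a)
    (hp₀ : ∀ θ, 0 < p₀ θ) [IsProbabilityMeasure (prior μbar p₀)] {L : NNReal}
    (hp₀L : LipschitzWith L fun θ => Real.log (p₀ θ)) (hdc0 : 0 < dc)
    (hdc : IsDecouplingCoeff r θs dc)
    (h0 : 0 < p₀ θs * μbar.real {θ | dist θ θs ≤ 2 / (L₀ * T)})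
    (h1 : p₀ θs * μbar.real {θ | dist θ θs ≤ 2 / (L₀ * T)} < 1) :
    Integrable (p.regret r act θs T) Pr ∧
    ∫ ω, p.regret r act θs T ω ∂Pr ≤
      4 + 5 * Real.exp B * √(T * dc * logTerm μbar p₀ θs L₀ T) *
        (2 + (1 + 2 * L / (L₀ * T)) / logTerm μbar p₀ θs L₀ T) := by
  have hl : 0 < logTerm μbar p₀ θs L₀ T := Real.log_pos (one_lt_one_div h0 h1)
  have hTr : (0 : ℝ) < T := by exact_mod_cast hT
  have hLr : (0 : ℝ) < L₀ := hL₀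
  rw [show (0.25 : ℝ) = 1 / 4 by norm_num] at h
  have hR := h.isRewardClass hT hr hB
  set μ := Real.exp (-B) / 5 * √(logTerm μbar p₀ θs L₀ T / (T * dc)) with hμ
  have hμ0 : 0 < μ := by positivity
  have hmass := prior_real_ge (μbar := μbar) hp₀ hp₀L θs (2 / (L₀ * T))
  have hs0 := (mul_pos (Real.exp_pos (-(L * (2 / (L₀ * T))))) h0).trans_le hmass
  have hε : ∀ θ ∈ {θ | dist θ θs ≤ 2 / (L₀ * T)}, ∀ x a, |r θ x a - r θs x a| ≤ 2 / T := by
    intro θ hθ x a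
    have h2 := (hrL x a).dist_le_mul θ θs
    rw [Real.dist_eq] at h2
    refine h2.trans ((mul_le_mul_of_nonneg_left hθ hLr.le).trans_eq ?_)
    field_simp
  have hbound := fun j => h.arm_regret_bound hR hdc hμ0
    Metric.isClosed_closedBall.measurableSet hs0 hε j
  obtain ⟨hi, heq⟩ := integral_regret_eq fun j => (hbound j).1
  refine ⟨hi, ?_⟩
  rw [heq]
  -- If all reward differences agree with the true ones, nothing forces `dc ≥ 1`, and the bound
  -- comes from vanishing regret instead.
  by_cases hdeg : ∀ θ x a b, rewardDiff r θ x a b = rewardDiff r θs x a b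
  · have hn := fun j => h.integral_regret_nonpos hdeg j
    have hpos : 0 ≤ 4 + 5 * Real.exp B * √(T * dc * logTerm μbar p₀ θs L₀ T) *
        (2 + (1 + 2 * L / (L₀ * T)) / logTerm μbar p₀ θs L₀ T) := by positivity
    linarith [hn 0, hn 1]
  · push Not at hdeg
    obtain ⟨θ, x, a, b, hne⟩ := hdeg
    have hdc1 : 1 ≤ dc := hdc.one_le hr hne
    have hB0 : 0 ≤ B := (abs_nonneg _).trans (hB θ x a)
    have hq : -(logTerm μbar p₀ θs L₀ T + 2 * L / (L₀ * T))
        ≤ Real.log ((prior μbar p₀).real {θ | dist θ θs ≤ 2 / (L₀ * T)}) := by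
      have h2 := Real.log_le_log (mul_pos (Real.exp_pos _) h0) hmass
      rw [Real.log_mul (Real.exp_ne_zero _) h0.ne', Real.log_exp] at h2
      refine le_trans (le_of_eq ?_) h2
      rw [logTerm, one_div, Real.log_inv]
      ring
    have hj := fun j => tuned_bound hB0 hTr hl hdc1 rfl hμ hq (hbound j).2
    linarith [hj 0, hj 1]

end RegretBound

end FGTS

theorem theorem3 {Θ X S A : Type*} [MetricSpace Θ] [MeasurableSpace Θ] [OpensMeasurableSpace Θ]
    [MeasurableSpace X] [MeasurableSpace S] [MeasurableSpace A]
    -- the parameter space, the reward class, the true parameter and the action spaces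
    (μbar : Measure Θ) (r : Θ → X → A → ℝ) (θs : Θ) (act : S → Set A)
    (hr : Measurable fun z : Θ × X × A => r z.1 z.2.1 z.2.2)
    (B : ℝ) (hB : ∀ θ x a, |r θ x a| ≤ B)
    (L₀ : NNReal) (hL₀ : 0 < L₀) (hrL : ∀ x a, LipschitzWith L₀ fun θ => r θ x a)
    -- the prior density
    (p₀ : Θ → ℝ) (hp₀ : ∀ θ, 0 < p₀ θ) (hp₀1 : IsProbabilityMeasure (prior μbar p₀))
    (L : NNReal) (hp₀L : LipschitzWith L fun θ => Real.log (p₀ θ))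
    -- the decoupling coefficient
    (dc : ℝ) (hdc0 : 0 < dc) (hdc : IsDecouplingCoeff r θs dc) :
    ∃ C : ℝ, ∀ T : ℕ, 1 ≤ T →
      0 < p₀ θs * μbar.real {θ | dist θ θs ≤ 2 / (L₀ * T)} →
      p₀ θs * μbar.real {θ | dist θ θs ≤ 2 / (L₀ * T)} < 1 →
      ∀ (Ω : Type*) [MeasurableSpace Ω] (Pr : Measure Ω) [IsProbabilityMeasure Pr]
        (p : Interaction Ω Θ X S A),
        IsFGTSRun p Pr r act μbar p₀ θs (η := 0.25)
          (μ := Real.exp (-B) / 5 * √(logTerm μbar p₀ θs L₀ T / (T * dc))) T →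
        Integrable (p.regret r act θs T) Pr ∧
        ∫ ω, p.regret r act θs T ω ∂Pr ≤
          4 + 5 * Real.exp B * √(T * dc * logTerm μbar p₀ θs L₀ T) *
            (2 + (1 + 2 * L / (L₀ * T)) / logTerm μbar p₀ θs L₀ T) ∧
        ∫ ω, p.regret r act θs T ω ∂Pr ≤ C * √(T * dc * logTerm μbar p₀ θs L₀ T) := by
  obtain ⟨l₀, hl₀, hmin⟩ := exists_pos_le_logTerm μbar (hp₀ θs) hL₀
  -- The additive `4` is absorbed through `T * dc * l ≥ dc * l₀`; in the bracket, `T ≥ 1` and `l ≥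
  -- l₀` are inserted.
  refine ⟨4 / √(dc * l₀) + 5 * Real.exp B * (2 + (1 + 2 * L / L₀) / l₀),
    fun T hT h0 h1 Ω _ Pr _ p hp => ?_⟩
  obtain ⟨hi, hb⟩ := hp.integral_regret_le hT hr hB hL₀ hrL hp₀ hp₀L hdc0 hdc h0 h1
  refine ⟨hi, hb, hb.trans ?_⟩
  have hl := hmin T hT h0 h1
  set l := logTerm μbar p₀ θs L₀ T
  have hT1 : (1 : ℝ) ≤ T := by exact_mod_cast hT
  have hLr : (0 : ℝ) < L₀ := hL₀
  have hl0 : 0 < l := hl₀.trans_le hl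
  have hs : √(dc * l₀) ≤ √(T * dc * l) := by
    apply Real.sqrt_le_sqrt
    calc dc * l₀ ≤ dc * l := by gcongr
      _ ≤ T * (dc * l) := le_mul_of_one_le_left (by positivity) hT1
      _ = T * dc * l := by ring
  have hs0 : 0 < √(dc * l₀) := Real.sqrt_pos.2 (by positivity)
  have hfour : 4 ≤ 4 / √(dc * l₀) * √(T * dc * l) := by
    rw [div_mul_eq_mul_div, le_div_iff₀ hs0]
    linarith
  have hfrac : (1 + 2 * L / (L₀ * T)) / l ≤ (1 + 2 * (L : ℝ) / L₀) / l₀ := by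
    gcongr
    exact le_mul_of_one_le_right hLr.le hT1
  calc 4 + 5 * Real.exp B * √(T * dc * l) * (2 + (1 + 2 * L / (L₀ * T)) / l)
      ≤ 4 / √(dc * l₀) * √(T * dc * l)
        + 5 * Real.exp B * √(T * dc * l) * (2 + (1 + 2 * (L : ℝ) / L₀) / l₀) := by gcongr
    _ = _ := by ring
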